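/- Let $d\ge 1$ and let $K\subset\mathbb R^d$ be a convex body (compact, convex, with nonempty interior) that is centrally symmetric about the origin. Let $r(u)=\max\{t\ge 0: tu\in K\}$, $u\in S^{d-1}$, be its radial function, so that the boundary is $\mathrm{Bd}(K)=\{r(u)u: u\in S^{d-1}\}$. Let $0<\varepsilon\le 1$ and suppose that $K$ is of class $C^{1+\varepsilon}$, i.e. $r$ is differentiable on $S^{d-1}$ and its first partial derivatives satisfy a $\mathrm{Lip}\,\varepsilon$ condition there: the function $R(x)=r(x/|x|)$ is differentiable at every point of $S^{d-1}$ and there is a constant $C$ such that $|\nabla R(u)-\nabla R(v)|\le C|u-v|^{\varepsilon}$ for all $u,v\in S^{d-1}$. Denote by $H_n^d$ the space of real homogeneous polynomials of degree $n$ in $d$ variables (including $0$). Then for every continuous function $f:\mathrm{Bd}(K)\to\mathbb R$ there exist $h_n\in H_n^d+H_{n-1}^d$, $n=1,2,3,\dots$, such that $h_n\to f$ uniformly on $\mathrm{Bd}(K)$ as $n\to\infty$. -/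

import Mathlib

open Set Filter Topology

/-- The radial function of `K`: for a unit vector `u` and a compact convex `K` with `0` in its
interior, `radial K u` is the positive number `r` for which `r • u` lies on the boundary of `K`. -/
noncomputable def radial {d : ℕ} (K : Set (EuclideanSpace ℝ (Fin d)))
    (u : EuclideanSpace ℝ (Fin d)) : ℝ :=
  sSup {t : ℝ | t • u ∈ K}

/-- The restriction of `radial K` to the unit sphere, extended to be constant on each open ray from
the origin, so that its derivative at a point of the sphere is the derivative along the sphere. -/
noncomputable def radialExt {d : ℕ} (K : Set (EuclideanSpace ℝ (Fin d)))
    (x : EuclideanSpace ℝ (Fin d)) : ℝ :=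
  radial K (‖x‖⁻¹ • x)

/-- `K` is of class `C^{1+ε}`: its radial function is differentiable on the unit sphere and its
first derivatives satisfy a Lipschitz (Hölder) condition of order `ε` there. -/
def IsC1Plus {d : ℕ} (ε : ℝ) (K : Set (EuclideanSpace ℝ (Fin d))) : Prop :=
  (∀ u ∈ Metric.sphere (0 : EuclideanSpace ℝ (Fin d)) 1, DifferentiableAt ℝ (radialExt K) u) ∧
  ∃ C : ℝ, ∀ u ∈ Metric.sphere (0 : EuclideanSpace ℝ (Fin d)) 1,
    ∀ v ∈ Metric.sphere (0 : EuclideanSpace ℝ (Fin d)) 1,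
      ‖fderiv ℝ (radialExt K) u - fderiv ℝ (radialExt K) v‖ ≤ C * ‖u - v‖ ^ ε

/-! The heart of the matter is the case f = 1. On Bd(K) the gauge N equals 1. For a unit vector u,
the derivative L_u of N at u satisfies |L_u| ≤ N by convexity and symmetry, and the C^{1+ε}
hypothesis gives L_u(v) ≥ N(v) - H|u-v|^{1+ε} for unit v (`isHolderGauge_gauge`). Hence L_u^{2n} = 1
- O(n^{-ε}) at boundary points whose direction is within O(1/n) of ±u.

To localise there, let J be the (d+1)-st power of a Fejér kernel of order k = ⌊n/(d+1)⌋, so that deg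
J < n, and let Q_u(x) = βN(u)²(|x|² - ⟨u,x⟩²). Then L_u^{2n} J(Q_u/L_u²) is a homogeneous polynomial
of degree 2n. At the boundary point in direction v it differs from J(β sin²∠(u,v)) by a small
multiple of the profile (1 + k² sin²∠(u,v))^{-d} (`abs_localisedPower_sub_le`). The frozen kernel
depends only on the angle, so its integral over u is a number Z independent of v, and the integral
of the profile is O(Z). Integrating over u and dividing by Z gives homogeneous polynomials of degree
2n tending to 1 (`exists_isHomogeneous_near_one`).

For general f, take a polynomial close to f by Stone–Weierstrass and multiply its component of
degree j by an approximant of 1 of degree 2⌊(n-j)/2⌋. The product has degree n or n-1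
(`exists_homogeneous_pair_near`). -/

/-! ### A Fejér-type algebraic kernel -/

section FejerKernel

open Polynomial

/-- The Dirichlet kernel `1 + 2 ∑_{1 ≤ j ≤ i} cos (j θ)`, written as a polynomial in `cos θ`. -/
noncomputable def dirichletPoly (i : ℕ) : ℝ[X] :=
  1 + 2 * ∑ j ∈ Finset.range i, Chebyshev.T ℝ ((j : ℤ) + 1)

/-- The (unnormalised) Fejér kernel `(1 - cos (k θ)) / (1 - cos θ)`, written as a polynomial in
`cos θ`. -/
noncomputable def fejerPoly (k : ℕ) : ℝ[X] := ∑ i ∈ Finset.range k, dirichletPoly i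

/-- The Fejér kernel transported to `[0, 1]` with its peak at `0`, normalised to be `1` there. -/
noncomputable def fejerBump (k : ℕ) : ℝ[X] :=
  C (((k : ℝ) ^ 2)⁻¹) * (fejerPoly k).comp (1 - 2 * X)

theorem dirichletPoly_eval (i : ℕ) (x : ℝ) :
    (dirichletPoly i).eval x
      = 1 + 2 * ∑ j ∈ Finset.range i, (Chebyshev.T ℝ ((j : ℤ) + 1)).eval x := by
  simp [dirichletPoly, eval_finsetSum]

theorem fejerPoly_eval (k : ℕ) (x : ℝ) :
    (fejerPoly k).eval x = ∑ i ∈ Finset.range k, (dirichletPoly i).eval x := by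
  simp [fejerPoly, eval_finsetSum]

theorem fejerBump_eval (k : ℕ) (t : ℝ) :
    (fejerBump k).eval t = ((k : ℝ) ^ 2)⁻¹ * (fejerPoly k).eval (1 - 2 * t) := by
  simp [fejerBump, eval_comp]

theorem one_sub_mul_dirichletPoly (i : ℕ) (x : ℝ) :
    (1 - x) * (dirichletPoly i).eval x
      = (Chebyshev.T ℝ (i : ℤ)).eval x - (Chebyshev.T ℝ ((i : ℤ) + 1)).eval x := by
  induction i with
  | zero => simp [dirichletPoly]
  | succ i ih =>
    have h := congrArg (eval x) (Chebyshev.T_add_two ℝ (i : ℤ))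
    simp only [eval_sub, eval_mul, eval_X, eval_ofNat] at h
    rw [dirichletPoly_eval] at ih ⊢
    rw [Finset.sum_range_succ]
    push_cast
    rw [add_assoc (i : ℤ) 1 1, one_add_one_eq_two, h]
    linear_combination ih

/-- Telescoping sum of the previous identity. As |T_k| ≤ 1 on [-1, 1], it yields both the
nonnegativity of the kernel and its decay away from the peak. -/
theorem one_sub_mul_fejerPoly (k : ℕ) (x : ℝ) :
    (1 - x) * (fejerPoly k).eval x = 1 - (Chebyshev.T ℝ (k : ℤ)).eval x := by
  induction k with
  | zero => simp [fejerPoly]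
  | succ k ih =>
    have h := one_sub_mul_dirichletPoly k x
    rw [fejerPoly_eval] at ih ⊢
    rw [Finset.sum_range_succ]
    push_cast
    linear_combination ih + h

theorem sum_range_two_mul_add_one (k : ℕ) :
    ∑ i ∈ Finset.range k, (1 + 2 * (i : ℝ)) = (k : ℝ) ^ 2 := by
  induction k with
  | zero => simp
  | succ k ih => rw [Finset.sum_range_succ, ih]; push_cast; ring

theorem abs_dirichletPoly_le {x B : ℝ} (i : ℕ) (hB : 1 ≤ B)
    (h : ∀ j < i, |(Chebyshev.T ℝ ((j : ℤ) + 1)).eval x| ≤ B) :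
    |(dirichletPoly i).eval x| ≤ (1 + 2 * i) * B := by
  have h1 : |∑ j ∈ Finset.range i, (Chebyshev.T ℝ ((j : ℤ) + 1)).eval x| ≤ i * B := by
    refine (Finset.abs_sum_le_sum_abs _ _).trans ?_
    refine (Finset.sum_le_card_nsmul _ _ B fun j hj => h j (Finset.mem_range.1 hj)).trans ?_
    simp
  rw [dirichletPoly_eval]
  have h2 := abs_add_le 1 (2 * ∑ j ∈ Finset.range i, (Chebyshev.T ℝ ((j : ℤ) + 1)).eval x)
  rw [abs_mul, abs_one, abs_two] at h2
  linarith

/-- The kernel is a sum of Chebyshev values with total weight k². The bound B is left free: it is 1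
on [-1, 1] and a power of the argument outside. -/
theorem abs_fejerPoly_le {x B : ℝ} (k : ℕ) (hB : 1 ≤ B)
    (h : ∀ j, j + 1 < k → |(Chebyshev.T ℝ ((j : ℤ) + 1)).eval x| ≤ B) :
    |(fejerPoly k).eval x| ≤ (k : ℝ) ^ 2 * B := by
  rw [fejerPoly_eval, ← sum_range_two_mul_add_one, Finset.sum_mul]
  refine (Finset.abs_sum_le_sum_abs _ _).trans (Finset.sum_le_sum fun i hi => ?_)
  exact abs_dirichletPoly_le i hB fun j hj => h j (by have := Finset.mem_range.1 hi; omega)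

/-- Mean value inequality: on [-1, 1] the derivative j U_{j-1} is largest in modulus at 1, where it
is j². -/
theorem abs_T_sub_le (j : ℕ) {x y : ℝ} (hx : x ∈ Icc (-1 : ℝ) 1) (hy : y ∈ Icc (-1 : ℝ) 1) :
    |(Chebyshev.T ℝ (j : ℤ)).eval x - (Chebyshev.T ℝ (j : ℤ)).eval y| ≤ (j : ℝ) ^ 2 * |x - y| := by
  refine (convex_Icc (-1 : ℝ) 1).norm_image_sub_le_of_norm_deriv_le
    (f := fun x => (Chebyshev.T ℝ (j : ℤ)).eval x)
    (fun z _ => Polynomial.differentiableAt _) (fun z hz => ?_) hy hx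
  rw [Polynomial.deriv, Real.norm_eq_abs]
  have h := Chebyshev.abs_iterate_derivative_T_real_le (j : ℤ) 1 (abs_le.2 hz)
  have h1 : eval 1 (Chebyshev.U ℝ ((j : ℤ) - 1)) = j := by simp
  simpa [Chebyshev.T_derivative_eq_U, h1, sq] using h

theorem abs_fejerPoly_sub_le (k : ℕ) {x y : ℝ} (hx : x ∈ Icc (-1 : ℝ) 1)
    (hy : y ∈ Icc (-1 : ℝ) 1) :
    |(fejerPoly k).eval x - (fejerPoly k).eval y| ≤ 2 * (k : ℝ) ^ 4 * |x - y| := by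
  have hD : ∀ i < k, |(dirichletPoly i).eval x - (dirichletPoly i).eval y|
      ≤ 2 * (k : ℝ) ^ 3 * |x - y| := by
    intro i hi
    have hik : (i : ℝ) + 1 ≤ k := by exact_mod_cast hi
    rw [dirichletPoly_eval, dirichletPoly_eval]
    have : ∀ a b : ℝ, 1 + 2 * a - (1 + 2 * b) = 2 * (a - b) := fun a b => by ring
    rw [this, abs_mul, abs_two, ← Finset.sum_sub_distrib, mul_assoc]
    refine mul_le_mul_of_nonneg_left ?_ zero_le_two
    refine (Finset.abs_sum_le_sum_abs _ _).trans ?_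
    refine (Finset.sum_le_card_nsmul _ _ ((k : ℝ) ^ 2 * |x - y|) fun j hj => ?_).trans ?_
    · refine (by exact_mod_cast abs_T_sub_le (j + 1) hx hy :
        |(Chebyshev.T ℝ ((j : ℤ) + 1)).eval x - (Chebyshev.T ℝ ((j : ℤ) + 1)).eval y|
          ≤ ((j : ℝ) + 1) ^ 2 * |x - y|).trans ?_
      have : (j : ℝ) + 1 ≤ i := by exact_mod_cast Finset.mem_range.1 hj
      gcongr
      linarith
    · rw [Finset.card_range, nsmul_eq_mul]
      calc (i : ℝ) * ((k : ℝ) ^ 2 * |x - y|) ≤ (k : ℝ) * ((k : ℝ) ^ 2 * |x - y|) := by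
            gcongr
        _ = _ := by ring
  rw [fejerPoly_eval, fejerPoly_eval, ← Finset.sum_sub_distrib]
  refine (Finset.abs_sum_le_sum_abs _ _).trans ?_
  refine (Finset.sum_le_card_nsmul _ _ _ fun i hi => hD i (Finset.mem_range.1 hi)).trans ?_
  rw [Finset.card_range, nsmul_eq_mul]
  exact le_of_eq (by ring)

/-- In T_{j+1} = 2x T_j - T_{j-1} the subtracted term is positive. Integer indices make this valid
from j = 0 on. -/
theorem abs_T_le_two_mul_pow (j : ℕ) {x : ℝ} (hx : 1 ≤ x) :
    |(Chebyshev.T ℝ (j : ℤ)).eval x| ≤ (2 * x) ^ j := by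
  have h1 : ∀ j : ℤ, 1 ≤ (Chebyshev.T ℝ j).eval x := fun j => Chebyshev.one_le_eval_T_real j hx
  rw [abs_of_nonneg (by linarith [h1 j])]
  induction j with
  | zero => simp
  | succ j ih =>
    have h := congrArg (eval x) (Chebyshev.T_add_one ℝ (j : ℤ))
    simp only [eval_sub, eval_mul, eval_X, eval_ofNat] at h
    push_cast
    rw [h, pow_succ]
    nlinarith [h1 (j - 1)]

theorem fejerBump_eval_zero {k : ℕ} (hk : 0 < k) : (fejerBump k).eval 0 = 1 := by
  have hk' : (k : ℝ) ≠ 0 := by positivity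
  rw [fejerBump_eval, fejerPoly_eval]
  simp only [dirichletPoly_eval, mul_zero, sub_zero, Chebyshev.T_eval_one, Finset.sum_const,
    Finset.card_range, nsmul_eq_mul, mul_one]
  rw [sum_range_two_mul_add_one, inv_mul_cancel₀ (by positivity)]

theorem mul_fejerBump_eval {k : ℕ} (hk : 0 < k) (t : ℝ) :
    2 * (k : ℝ) ^ 2 * t * (fejerBump k).eval t
      = 1 - (Chebyshev.T ℝ (k : ℤ)).eval (1 - 2 * t) := by
  have hk' : (k : ℝ) ≠ 0 := by positivity
  rw [← one_sub_mul_fejerPoly, fejerBump_eval]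
  field_simp
  ring

theorem one_sub_two_mul_mem {t : ℝ} (ht : t ∈ Icc (0 : ℝ) 1) : 1 - 2 * t ∈ Icc (-1 : ℝ) 1 :=
  ⟨by linarith [ht.2], by linarith [ht.1]⟩

theorem fejerBump_nonneg {k : ℕ} (hk : 0 < k) {t : ℝ} (ht : t ∈ Icc (0 : ℝ) 1) :
    0 ≤ (fejerBump k).eval t := by
  have hk' : (0 : ℝ) < k := by positivity
  rcases ht.1.eq_or_lt with rfl | h0
  · simp [fejerBump_eval_zero hk]
  · have h := mul_fejerBump_eval hk t
    have h1 := (Chebyshev.eval_T_real_mem_Icc (k : ℤ) (one_sub_two_mul_mem ht)).2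
    refine nonneg_of_mul_nonneg_right (a := 2 * (k : ℝ) ^ 2 * t) ?_ (by positivity)
    linarith

theorem fejerBump_le_one {k : ℕ} (hk : 0 < k) {t : ℝ} (ht : t ∈ Icc (0 : ℝ) 1) :
    (fejerBump k).eval t ≤ 1 := by
  have hk' : (0 : ℝ) < k := by positivity
  have h := abs_fejerPoly_le (x := 1 - 2 * t) k le_rfl fun j _ =>
    Chebyshev.abs_eval_T_real_le_one _ (abs_le.2 (one_sub_two_mul_mem ht))
  rw [fejerBump_eval, inv_mul_le_iff₀ (by positivity)]
  exact (le_abs_self _).trans h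

theorem sq_mul_fejerBump_le {k : ℕ} (hk : 0 < k) {t : ℝ} (ht : t ∈ Icc (0 : ℝ) 1) :
    (k : ℝ) ^ 2 * t * (fejerBump k).eval t ≤ 1 := by
  have h := mul_fejerBump_eval hk t
  have h1 := (Chebyshev.eval_T_real_mem_Icc (k : ℤ) (one_sub_two_mul_mem ht)).1
  nlinarith

theorem abs_fejerBump_sub_le {k : ℕ} (hk : 0 < k) {s t : ℝ} (hs : s ∈ Icc (0 : ℝ) 1)
    (ht : t ∈ Icc (0 : ℝ) 1) :
    |(fejerBump k).eval s - (fejerBump k).eval t| ≤ 4 * (k : ℝ) ^ 2 * |s - t| := by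
  have hk' : (0 : ℝ) < k := by positivity
  have h := abs_fejerPoly_sub_le k (one_sub_two_mul_mem hs) (one_sub_two_mul_mem ht)
  have h2 : |1 - 2 * s - (1 - 2 * t)| = 2 * |s - t| := by
    rw [show 1 - 2 * s - (1 - 2 * t) = -(2 * (s - t)) by ring, abs_neg, abs_mul, abs_two]
  rw [h2] at h
  rw [fejerBump_eval, fejerBump_eval, ← mul_sub, abs_mul, abs_of_pos (by positivity),
    inv_mul_le_iff₀ (by positivity)]
  refine h.trans (le_of_eq (by ring))

/-- Needed because the argument Q_u/L_u² is unbounded near the zeros of L_u. -/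
theorem abs_fejerBump_le_pow {k : ℕ} (hk : 0 < k) {t : ℝ} (ht : 1 ≤ t) :
    |(fejerBump k).eval t| ≤ (4 * t) ^ (k - 1) := by
  have hk' : (0 : ℝ) < k := by positivity
  rw [fejerBump_eval, abs_mul, abs_of_pos (by positivity), inv_mul_le_iff₀ (by positivity)]
  refine abs_fejerPoly_le k (one_le_pow₀ (by linarith)) fun j hj => ?_
  rw [show (1 - 2 * t : ℝ) = -(2 * t - 1) by ring, Chebyshev.T_eval_neg, abs_mul]
  have h := abs_T_le_two_mul_pow (j + 1) (x := 2 * t - 1) (by linarith)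
  push_cast at h
  have h1 : |(((j : ℤ) + 1).negOnePow : ℝ)| = 1 := by
    rcases Int.even_or_odd ((j : ℤ) + 1) with he | ho
    · simp [Int.negOnePow_even _ he]
    · simp [Int.negOnePow_odd _ ho]
  rw [h1, one_mul]
  calc _ ≤ (2 * (2 * t - 1)) ^ (j + 1) := h
    _ ≤ (4 * t) ^ (j + 1) := pow_le_pow_left₀ (by linarith) (by linarith) _
    _ ≤ (4 * t) ^ (k - 1) := pow_le_pow_right₀ (by linarith) (by omega)

theorem natDegree_dirichletPoly_le (i : ℕ) : (dirichletPoly i).natDegree ≤ i := by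
  refine natDegree_add_le_of_degree_le (by simp) ?_
  refine (natDegree_mul_le).trans ?_
  have : (2 : ℝ[X]).natDegree = 0 := natDegree_ofNat 2
  rw [this, zero_add]
  refine natDegree_sum_le_of_forall_le _ _ fun j hj => ?_
  rw [Chebyshev.natDegree_T]
  have := Finset.mem_range.1 hj
  omega

theorem natDegree_fejerBump_le (k : ℕ) : (fejerBump k).natDegree ≤ k - 1 := by
  refine (natDegree_C_mul_le _ _).trans ?_
  rw [natDegree_comp]
  have h1 : (fejerPoly k).natDegree ≤ k - 1 := by
    refine natDegree_sum_le_of_forall_le _ _ fun i hi => ?_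
    have := Finset.mem_range.1 hi
    exact (natDegree_dirichletPoly_le i).trans (by omega)
  have h2 : (1 - 2 * X : ℝ[X]).natDegree ≤ 1 := by compute_degree
  calc _ ≤ (k - 1) * 1 := Nat.mul_le_mul h1 h2
    _ = _ := mul_one _

end FejerKernel

/-! ### The gauge of a symmetric convex body -/

section Gauge

variable {d : ℕ} {s : Set (EuclideanSpace ℝ (Fin d))}

theorem mem_nhds_zero_of_symmetric (hc : Convex ℝ s) (hint : (interior s).Nonempty)
    (hsymm : ∀ x ∈ s, -x ∈ s) : s ∈ 𝓝 0 := by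
  obtain ⟨x, hx⟩ := hint
  have hneg : -s = s := by
    ext y
    exact ⟨fun h => by simpa using hsymm _ h, fun h => hsymm _ h⟩
  have hx' : -x ∈ interior s := by
    have h := (Homeomorph.neg (EuclideanSpace ℝ (Fin d))).preimage_interior s
    have h2 : (Homeomorph.neg (EuclideanSpace ℝ (Fin d))) ⁻¹' s = s := hneg
    rw [h2] at h
    rw [← h] at hx
    exact hx
  have h0 : (0 : EuclideanSpace ℝ (Fin d)) ∈ interior s := by
    have := hc.interior hx hx' (a := 1 / 2) (b := 1 / 2) (by norm_num) (by norm_num) (by norm_num)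
    simpa using this
  exact mem_interior_iff_mem_nhds.1 h0

/-- A function with the properties of the gauge of a symmetric convex body of class `C^{1+ε}`,
with explicit constants. -/
structure IsHolderGauge (N : EuclideanSpace ℝ (Fin d) → ℝ) (ε a b H : ℝ) : Prop where
  a_pos : 0 < a
  b_pos : 0 < b
  H_nonneg : 0 ≤ H
  le_gauge : ∀ u, ‖u‖ = 1 → a ≤ N u
  gauge_le : ∀ u, ‖u‖ = 1 → N u ≤ b
  abs_sub_le : ∀ x y, |N x - N y| ≤ b * ‖x - y‖
  map_neg : ∀ x, N (-x) = N x
  map_smul : ∀ t : ℝ, 0 ≤ t → ∀ x, N (t • x) = t * N x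
  fderiv_le : ∀ u, ‖u‖ = 1 → ∀ x, fderiv ℝ N u x ≤ N x
  tangent : ∀ u v, ‖u‖ = 1 → ‖v‖ = 1 → N v - H * ‖u - v‖ ^ (1 + ε) ≤ fderiv ℝ N u v

theorem radial_eq_inv_gauge (hc : Convex ℝ s) (hs : IsCompact s) (h0 : s ∈ 𝓝 0)
    {u : EuclideanSpace ℝ (Fin d)} (hu : u ≠ 0) : radial s u = (gauge s u)⁻¹ := by
  have hpos : 0 < gauge s u := (gauge_pos (absorbent_nhds_zero h0)
    (NormedSpace.isVonNBounded_of_isBounded ℝ hs.isBounded)).2 hu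
  have hmem : ∀ x, x ∈ s ↔ gauge s x ≤ 1 := fun x => by
    rw [gauge_le_one_iff_mem_closure hc h0, hs.isClosed.closure_eq]
  refine IsGreatest.csSup_eq ⟨?_, ?_⟩
  · rw [Set.mem_ofPred_eq, hmem, gauge_smul_of_nonneg (inv_nonneg.2 hpos.le), smul_eq_mul,
      inv_mul_cancel₀ hpos.ne']
  · intro t ht
    rcases le_total t 0 with h | h
    · exact h.trans (inv_nonneg.2 hpos.le)
    · rw [Set.mem_ofPred_eq, hmem, gauge_smul_of_nonneg h, smul_eq_mul] at ht
      rwa [← one_div, le_div_iff₀ hpos]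

theorem gauge_mul_radialExt (hc : Convex ℝ s) (hs : IsCompact s) (h0 : s ∈ 𝓝 0)
    {x : EuclideanSpace ℝ (Fin d)} (hx : x ≠ 0) : gauge s x * radialExt s x = ‖x‖ := by
  have hpos : 0 < gauge s x := (gauge_pos (absorbent_nhds_zero h0)
    (NormedSpace.isVonNBounded_of_isBounded ℝ hs.isBounded)).2 hx
  have hn : 0 < ‖x‖ := norm_pos_iff.2 hx
  rw [radialExt, radial_eq_inv_gauge hc hs h0 (by simp [hx]),
    gauge_smul_of_nonneg (by positivity), smul_eq_mul]
  field_simp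

/-- Differentiate N·R = |x|, where R is the extended radial function. This transfers the Hölder
condition from R to N. -/
theorem fderiv_gauge (hc : Convex ℝ s) (hs : IsCompact s) (h0 : s ∈ 𝓝 0)
    {u : EuclideanSpace ℝ (Fin d)} (hu : ‖u‖ = 1) (hd : DifferentiableAt ℝ (radialExt s) u) :
    DifferentiableAt ℝ (gauge s) u ∧ fderiv ℝ (gauge s) u
      = gauge s u • innerSL ℝ u - gauge s u ^ 2 • fderiv ℝ (radialExt s) u := by
  have hu0 : u ≠ 0 := by rintro rfl; simp at hu
  have hmul : ∀ x ≠ 0, gauge s x * radialExt s x = ‖x‖ := fun x hx =>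
    gauge_mul_radialExt hc hs h0 hx
  have hu1 : gauge s u * radialExt s u = 1 := by rw [hmul u hu0, hu]
  have hR : radialExt s u ≠ 0 := right_ne_zero_of_mul_eq_one hu1
  have hNd : DifferentiableAt ℝ (gauge s) u := by
    have h1 : DifferentiableAt ℝ (fun x => ‖x‖ * (radialExt s x)⁻¹) u :=
      (differentiableAt_id.norm ℝ hu0).fun_mul (hd.fun_inv hR)
    refine h1.congr_of_eventuallyEq ?_
    filter_upwards [isOpen_ne.mem_nhds hu0] with x hx
    have hx' : ‖x‖ ≠ 0 := norm_ne_zero_iff.2 hx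
    rw [← hmul x hx, mul_inv_cancel_right₀]
    intro h
    rw [← hmul x hx, h, mul_zero] at hx'
    exact hx' rfl
  refine ⟨hNd, ?_⟩
  have h := HasFDerivAt.fun_mul hNd.hasFDerivAt hd.hasFDerivAt
  -- Squaring the relation brings in the explicit derivative of |x|².
  have h1 := HasFDerivAt.fun_mul h h
  have h2 : HasFDerivAt (fun x => ‖x‖ ^ 2) (2 • innerSL ℝ u) u :=
    (hasStrictFDerivAt_norm_sq u).hasFDerivAt
  have h3 : (fun x => gauge s x * radialExt s x * (gauge s x * radialExt s x)) =ᶠ[𝓝 u] fun x => ‖x‖ ^ 2 := by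
    filter_upwards [isOpen_ne.mem_nhds hu0] with x hx
    rw [hmul x hx, sq]
  have h4 := (h2.congr_of_eventuallyEq h3).unique h1
  ext y
  have h5 := congrArg (fun φ => φ y) h4
  simp [hu1] at h5
  simp
  linear_combination (-fderiv ℝ (gauge s) u y) * hu1 - gauge s u / 2 * h5

theorem tendsto_slope_gauge {N : EuclideanSpace ℝ (Fin d) → ℝ} {u : EuclideanSpace ℝ (Fin d)}
    (hN : DifferentiableAt ℝ N u) (x : EuclideanSpace ℝ (Fin d)) :
    Tendsto (fun t : ℝ => t⁻¹ * (N (u + t • x) - N u)) (𝓝[>] 0) (𝓝 (fderiv ℝ N u x)) := by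
  have h := (hN.hasFDerivAt.hasLineDerivAt x).tendsto_slope_zero_right
  simpa using h

/-- Subadditivity gives L_u ≤ N and homogeneity gives L_u(u) = N(u). Since L_v(u) ≤ N(u), it follows
that N(v) - L_u(v) ≤ (L_v - L_u)(v - u), and the Hölder bound on L_v - L_u supplies the exponent 1 +
ε. -/
theorem isHolderGauge_gauge {ε : ℝ} (hε : 0 < ε) (hε1 : ε ≤ 1) (hc : Convex ℝ s)
    (hs : IsCompact s) (h0 : s ∈ 𝓝 0) (hsymm : ∀ x ∈ s, -x ∈ s) (hK : IsC1Plus ε s) :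
    ∃ a b H, IsHolderGauge (gauge s) ε a b H := by
  obtain ⟨hdiff, C, hC⟩ := hK
  simp only [mem_sphere_zero_iff_norm] at hdiff hC
  obtain ⟨r, hr, hrs⟩ := Metric.mem_nhds_iff.1 h0
  obtain ⟨ρ, hρ, hsρ⟩ := hs.isBounded.subset_closedBall_lt 0 0
  have habs : Absorbent ℝ s := absorbent_nhds_zero h0
  have hle : ∀ u, ‖u‖ = 1 → gauge s u ≤ r⁻¹ := fun u hu => by
    have := mul_gauge_le_norm (x := u) hrs
    rw [hu] at this
    rwa [← one_div, le_div_iff₀' hr]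
  have hlip : ∀ x y, |gauge s x - gauge s y| ≤ r⁻¹ * ‖x - y‖ := fun x y => by
    have := (hc.lipschitzWith_gauge (r := ⟨r, hr.le⟩) hr hrs).dist_le_mul x y
    rw [Real.dist_eq, dist_eq_norm] at this
    exact this
  have hder : ∀ u, ‖u‖ = 1 → _ := fun u hu => fderiv_gauge hc hs h0 hu (hdiff u hu)
  have hfd : ∀ u, ‖u‖ = 1 → ∀ x, fderiv ℝ (gauge s) u x ≤ gauge s x := fun u hu x => by
    refine le_of_tendsto (tendsto_slope_gauge (hder u hu).1 x) ?_
    filter_upwards [self_mem_nhdsWithin] with t ht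
    have ht' : (0 : ℝ) < t := ht
    have h1 := gauge_add_le hc habs u (t • x)
    rw [gauge_smul_of_nonneg ht'.le, smul_eq_mul] at h1
    rw [inv_mul_le_iff₀ ht']
    linarith
  have hself : ∀ u, ‖u‖ = 1 → fderiv ℝ (gauge s) u u = gauge s u := fun u hu => by
    refine tendsto_nhds_unique (tendsto_slope_gauge (hder u hu).1 u) ?_
    refine tendsto_const_nhds.congr' ?_
    filter_upwards [self_mem_nhdsWithin] with t ht
    have ht' : (0 : ℝ) < t := ht
    rw [show u + t • u = (1 + t) • u by rw [add_smul, one_smul],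
      gauge_smul_of_nonneg (by positivity), smul_eq_mul]
    field_simp
    ring
  obtain ⟨B, hB0, hB⟩ : ∃ B : ℝ, 0 ≤ B ∧ ∀ u, ‖u‖ = 1 → ‖fderiv ℝ (radialExt s) u‖ ≤ B := by
    by_cases hne : ∃ u₀ : EuclideanSpace ℝ (Fin d), ‖u₀‖ = 1
    · obtain ⟨u₀, hu₀⟩ := hne
      refine ⟨‖fderiv ℝ (radialExt s) u₀‖ + |C| * 2 ^ ε, by positivity, fun u hu => ?_⟩
      have h1 := norm_le_norm_add_norm_sub' (fderiv ℝ (radialExt s) u) (fderiv ℝ (radialExt s) u₀)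
      have h2 : ‖u - u₀‖ ≤ 2 := (norm_sub_le _ _).trans (by rw [hu, hu₀]; norm_num)
      have h3 : C * ‖u - u₀‖ ^ ε ≤ |C| * 2 ^ ε := by
        gcongr
        exact le_abs_self C
      linarith [hC u hu u₀ hu₀]
    · exact ⟨0, le_rfl, fun u hu => (hne ⟨u, hu⟩).elim⟩
  have hb : 0 < r⁻¹ := inv_pos.2 hr
  set b := r⁻¹
  -- The first summand collects the Lipschitz terms, doubled because δ ≤ 2δ^ε on the sphere; the
  -- second comes from the Hölder condition on the radial function.
  set H := 2 * (2 * b + 2 * b ^ 2 * B) + b ^ 2 * |C| with hH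
  have hH0 : 0 ≤ H := by positivity
  have hhol : ∀ u v, ‖u‖ = 1 → ‖v‖ = 1 →
      ‖fderiv ℝ (gauge s) v - fderiv ℝ (gauge s) u‖ ≤ H * ‖u - v‖ ^ ε := by
    intro u v hu hv
    rw [(hder u hu).2, (hder v hv).2]
    set δ := ‖u - v‖ with hδ
    have hδ0 : 0 ≤ δ := norm_nonneg _
    have hδ2 : δ ≤ 2 := (norm_sub_le _ _).trans (by rw [hu, hv]; norm_num)
    have hδε : δ ≤ 2 * δ ^ ε := by
      rcases le_total δ 1 with h | h
      · have := Real.rpow_le_rpow_of_exponent_ge' hδ0 h hε.le hε1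
        rw [Real.rpow_one] at this
        linarith
      · have := Real.one_le_rpow h hε.le
        linarith
    have hl := hlip v u
    rw [norm_sub_rev, ← hδ] at hl
    have e : gauge s v • innerSL ℝ v - gauge s v ^ 2 • fderiv ℝ (radialExt s) v -
        (gauge s u • innerSL ℝ u - gauge s u ^ 2 • fderiv ℝ (radialExt s) u)
        = (gauge s v - gauge s u) • innerSL ℝ v - gauge s u • innerSL ℝ (u - v)
          - ((gauge s v - gauge s u) * (gauge s v + gauge s u)) • fderiv ℝ (radialExt s) v
          + gauge s u ^ 2 • (fderiv ℝ (radialExt s) u - fderiv ℝ (radialExt s) v) := by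
      rw [map_sub]
      module
    have n1 : ‖(gauge s v - gauge s u) • innerSL ℝ v‖ ≤ b * δ := by
      rw [norm_smul, innerSL_apply_norm, hv, mul_one]
      exact hl
    have n2 : ‖gauge s u • innerSL ℝ (u - v)‖ ≤ b * δ := by
      rw [norm_smul, innerSL_apply_norm, Real.norm_of_nonneg (gauge_nonneg _)]
      gcongr
      exact hle u hu
    have n3 : ‖((gauge s v - gauge s u) * (gauge s v + gauge s u)) • fderiv ℝ (radialExt s) v‖
        ≤ (b * δ) * (b + b) * B := by
      rw [norm_smul, norm_mul, Real.norm_of_nonneg (add_nonneg (gauge_nonneg _) (gauge_nonneg _))]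
      gcongr
      · exact add_nonneg (gauge_nonneg _) (gauge_nonneg _)
      · exact hl
      · exact hle v hv
      · exact hle u hu
      · exact hB v hv
    have n4 : ‖gauge s u ^ 2 • (fderiv ℝ (radialExt s) u - fderiv ℝ (radialExt s) v)‖
        ≤ b ^ 2 * (|C| * δ ^ ε) := by
      rw [norm_smul, norm_pow, Real.norm_of_nonneg (gauge_nonneg _)]
      have h1 := gauge_nonneg (s := s) u
      gcongr
      · exact hle u hu
      · refine (hC u hu v hv).trans ?_
        gcongr
        exact le_abs_self C
    rw [e]
    refine (norm_add_le _ _).trans ?_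
    have m1 := norm_sub_le ((gauge s v - gauge s u) • innerSL ℝ v - gauge s u • innerSL ℝ (u - v))
      (((gauge s v - gauge s u) * (gauge s v + gauge s u)) • fderiv ℝ (radialExt s) v)
    have m2 := norm_sub_le ((gauge s v - gauge s u) • innerSL ℝ v) (gauge s u • innerSL ℝ (u - v))
    have m3 : (2 * b + 2 * b ^ 2 * B) * δ ≤ (2 * b + 2 * b ^ 2 * B) * (2 * δ ^ ε) := by
      gcongr
    rw [hH]
    linarith
  refine ⟨ρ⁻¹, b, H, ?_⟩
  refine ⟨inv_pos.2 hρ, hb, hH0, fun u hu => ?_, hle, hlip, gauge_neg hsymm, fun t ht x => ?_, hfd,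
    fun u v hu hv => ?_⟩
  · have := le_gauge_of_subset_closedBall (x := u) habs hρ.le hsρ
    rwa [hu, one_div] at this
  · rw [gauge_smul_of_nonneg ht, smul_eq_mul]
  · have h1 := hhol u v hu hv
    have h2 := hfd v hv u
    have h3 := hself u hu
    have h4 := hself v hv
    have h5 := (fderiv ℝ (gauge s) v - fderiv ℝ (gauge s) u).le_opNorm (v - u)
    rw [norm_sub_rev v u] at h5
    have h6 := (le_abs_self _).trans h5
    have h7 : ‖u - v‖ ^ (1 + ε) = ‖u - v‖ ^ ε * ‖u - v‖ := by
      rw [add_comm, Real.rpow_add_one' (norm_nonneg _) (by positivity)]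
    have h8 := mul_le_mul_of_nonneg_right h1 (norm_nonneg (u - v))
    simp only [map_sub, sub_apply] at h6
    rw [h7]
    linarith

end Gauge

/-! ### Pointwise estimates for the localised powers of supporting functionals -/

section Pointwise

open Polynomial

theorem abs_pow_sub_pow_le_mul {x y : ℝ} (hx : x ∈ Icc (0 : ℝ) 1) (hy : y ∈ Icc (0 : ℝ) 1) (p : ℕ) :
    |x ^ p - y ^ p| ≤ p * |x - y| := by
  induction p with
  | zero => simp
  | succ p ih =>
    have e : x ^ (p + 1) - y ^ (p + 1) = x * (x ^ p - y ^ p) + (x - y) * y ^ p := by ring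
    have h1 : |x * (x ^ p - y ^ p)| ≤ p * |x - y| := by
      rw [abs_mul, abs_of_nonneg hx.1]
      nlinarith [abs_nonneg (x ^ p - y ^ p), hx.1, hx.2]
    have h2 : |(x - y) * y ^ p| ≤ |x - y| := by
      rw [abs_mul, abs_of_nonneg (pow_nonneg hy.1 p)]
      exact mul_le_of_le_one_right (abs_nonneg _) (pow_le_one₀ hy.1 hy.2)
    rw [e]
    push_cast
    linarith [abs_add_le (x * (x ^ p - y ^ p)) ((x - y) * y ^ p)]

theorem fejerBump_mem_Icc {k : ℕ} (hk : 0 < k) {t : ℝ} (ht : t ∈ Icc (0 : ℝ) 1) :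
    (fejerBump k).eval t ∈ Icc (0 : ℝ) 1 := ⟨fejerBump_nonneg hk ht, fejerBump_le_one hk ht⟩

theorem fejerBump_pow_le {k p : ℕ} (hk : 0 < k) {t m : ℝ} (ht : t ∈ Icc (0 : ℝ) 1)
    (hm : 0 < m) (hmt : m ≤ (k : ℝ) ^ 2 * t) : (fejerBump k).eval t ^ p ≤ (1 / m) ^ p := by
  have h := sq_mul_fejerBump_le hk ht
  have h0 := fejerBump_nonneg hk ht
  refine pow_le_pow_left₀ h0 ?_ p
  rw [le_div_iff₀ hm]
  nlinarith

/-- Let τ be the argument of the bump. If τ ≤ 1, the Fejér decay applies. If τ ≥ 1, the bump grows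
at most like (4τ)^n after the power p, but the factor 1/(16A) forces τℓ² ≤ 1/16, so ℓ^{2n} absorbs
this growth and leaves 4^{-n}. -/
theorem abs_localised_tail_le {k p n : ℕ} (hk : 0 < k) (hpk : p * (k - 1) ≤ n) {A σ ρ ℓ : ℝ}
    (hA : 1 ≤ A) (hσ0 : 0 < σ) (hσ1 : σ ≤ 1) (hρ : ρ ^ 2 ≤ A) (hρ' : 1 / A ≤ ρ ^ 2)
    (hℓ : |ℓ| ≤ 1) (hn : 0 < n) :
    |ℓ ^ (2 * n) * (fejerBump k).eval (1 / (16 * A) * σ * ρ ^ 2 / ℓ ^ 2) ^ p|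
      ≤ (16 * A ^ 2 / (k ^ 2 * σ)) ^ p + (1 / 4) ^ n := by
  have hk' : (0 : ℝ) < k := by positivity
  rcases eq_or_ne ℓ 0 with rfl | hℓ0
  · rw [zero_pow (by omega), zero_mul, abs_zero]
    positivity
  have hA0 : 0 < A := by linarith
  have hℓ2 : 0 < ℓ ^ 2 := by positivity
  have hℓ2' : ℓ ^ 2 ≤ 1 := (sq_le_one_iff_abs_le_one ℓ).2 hℓ
  have hρ0 : 0 < ρ ^ 2 := lt_of_lt_of_le (by positivity) hρ'
  set τ := 1 / (16 * A) * σ * ρ ^ 2 / ℓ ^ 2 with hτ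
  have hτ0 : 0 < τ := by positivity
  have hτℓ : τ * ℓ ^ 2 ≤ 1 / 16 := by
    rw [hτ, div_mul_cancel₀ _ hℓ2.ne']
    calc 1 / (16 * A) * σ * ρ ^ 2 ≤ 1 / (16 * A) * 1 * A := by gcongr
      _ = 1 / 16 := by field_simp
  rw [abs_mul, abs_pow, abs_pow, pow_mul, sq_abs]
  rcases le_total τ 1 with h1 | h1
  · have hm : 1 / (16 * A ^ 2 / (k ^ 2 * σ)) ≤ (k : ℝ) ^ 2 * τ := by
      have h2 : 1 / (16 * A) * σ * (1 / A) ≤ τ := by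
        rw [hτ, le_div_iff₀ hℓ2]
        calc 1 / (16 * A) * σ * (1 / A) * ℓ ^ 2 ≤ 1 / (16 * A) * σ * (1 / A) * 1 := by gcongr
          _ ≤ _ := by rw [mul_one]; gcongr
      calc _ = (k : ℝ) ^ 2 * (1 / (16 * A) * σ * (1 / A)) := by field_simp
        _ ≤ _ := by gcongr
    have h3 := fejerBump_pow_le (p := p) hk ⟨hτ0.le, h1⟩ (by positivity) hm
    rw [one_div_one_div] at h3
    rw [abs_of_nonneg (fejerBump_nonneg hk ⟨hτ0.le, h1⟩)]
    have h4 : (ℓ ^ 2) ^ n ≤ 1 := pow_le_one₀ hℓ2.le hℓ2'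
    have h5 := pow_nonneg (fejerBump_nonneg hk ⟨hτ0.le, h1⟩) p
    calc _ ≤ 1 * (fejerBump k).eval τ ^ p := by gcongr
      _ ≤ _ := by
        rw [one_mul]
        have : (0 : ℝ) ≤ (1 / 4) ^ n := by positivity
        linarith
  · have h2 : |(fejerBump k).eval τ| ^ p ≤ (4 * τ) ^ n := by
      calc |(fejerBump k).eval τ| ^ p ≤ ((4 * τ) ^ (k - 1)) ^ p := by
            gcongr
            exact abs_fejerBump_le_pow hk h1
        _ = (4 * τ) ^ (p * (k - 1)) := by rw [← pow_mul, mul_comm (k - 1) p]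
        _ ≤ (4 * τ) ^ n := pow_le_pow_right₀ (by linarith) hpk
    have h3 : (ℓ ^ 2) ^ n * |(fejerBump k).eval τ| ^ p ≤ (1 / 4) ^ n := by
      calc _ ≤ (ℓ ^ 2) ^ n * (4 * τ) ^ n := by gcongr
        _ = (4 * (τ * ℓ ^ 2)) ^ n := by rw [← mul_pow]; ring
        _ ≤ (1 / 4) ^ n := by
          gcongr
          linarith
    have h4 : 0 ≤ (16 * A ^ 2 / (k ^ 2 * σ)) ^ p := by positivity
    linarith

/-- Bernoulli's inequality controls ℓ^{2n}. The bump has Lipschitz constant 4k², but its argument is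
proportional to σ and changes only by a relative error of 8κ, so k²σ ≤ T keeps the change of order
Tκ. -/
theorem abs_localised_sub_le {k n : ℕ} (p : ℕ) (hk : 0 < k) {β T σ ρ ℓ κ : ℝ}
    (hβ0 : 0 ≤ β) (hβ : β ≤ 1 / 16) (hσ0 : 0 ≤ σ) (hσ1 : σ ≤ 1) (hT : k ^ 2 * σ ≤ T)
    (hκ : κ ≤ 1 / 4) (hℓ : 1 - κ ≤ ℓ) (hℓ1 : ℓ ≤ 1) (hρ : |ρ - 1| ≤ κ) :
    |ℓ ^ (2 * n) * (fejerBump k).eval (β * σ * ρ ^ 2 / ℓ ^ 2) ^ p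
      - (fejerBump k).eval (β * σ) ^ p| ≤ 2 * n * (1 - ℓ) + p * (32 * T * κ) := by
  obtain ⟨hρ1, hρ2⟩ := abs_le.1 hρ
  have hκ0 : 0 ≤ κ := (abs_nonneg _).trans hρ
  have hℓ0 : 0 < ℓ := by linarith
  have hℓ2 : 0 < ℓ ^ 2 := by positivity
  have hrat : |ρ ^ 2 / ℓ ^ 2 - 1| ≤ 8 * κ := by
    rw [abs_le]
    constructor
    · have : 1 - 8 * κ ≤ ρ ^ 2 / ℓ ^ 2 := by
        rw [le_div_iff₀ hℓ2]
        have h1 : 1 - 2 * κ ≤ ρ ^ 2 := by nlinarith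
        have h2 : ℓ ^ 2 ≤ 1 := pow_le_one₀ hℓ0.le hℓ1
        have h3 : 1 / 2 ≤ ℓ ^ 2 := by nlinarith
        nlinarith [mul_nonneg hκ0 (sub_nonneg.2 h3)]
      linarith
    · rw [sub_le_iff_le_add, div_le_iff₀ hℓ2]
      have h1 : ρ ^ 2 ≤ (1 + κ) ^ 2 := by nlinarith
      have h2 : (1 - κ) ^ 2 ≤ ℓ ^ 2 := by nlinarith
      have h3 : (8 * κ + 1) * (1 - κ) ^ 2 ≤ (8 * κ + 1) * ℓ ^ 2 := by gcongr
      nlinarith [mul_nonneg hκ0 hκ0, mul_nonneg hκ0 (mul_nonneg hκ0 hκ0),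
        mul_nonneg hκ0 (sub_nonneg.2 hκ)]
  obtain ⟨hr1, hr2⟩ := abs_le.1 hrat
  have hx0 : 0 ≤ ρ ^ 2 / ℓ ^ 2 := by positivity
  have hβσ : β * σ ≤ 1 / 16 := by nlinarith
  have hβσ0 : 0 ≤ β * σ := mul_nonneg hβ0 hσ0
  have e : β * σ * ρ ^ 2 / ℓ ^ 2 = β * σ * (ρ ^ 2 / ℓ ^ 2) := by ring
  have m1 : β * σ * (ρ ^ 2 / ℓ ^ 2) ∈ Icc (0 : ℝ) 1 := ⟨by positivity, by nlinarith⟩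
  have m2 : β * σ ∈ Icc (0 : ℝ) 1 := ⟨hβσ0, by linarith⟩
  rw [e]
  set x := (fejerBump k).eval (β * σ * (ρ ^ 2 / ℓ ^ 2))
  set y := (fejerBump k).eval (β * σ)
  have hx : x ∈ Icc (0 : ℝ) 1 := fejerBump_mem_Icc hk m1
  have hy : y ∈ Icc (0 : ℝ) 1 := fejerBump_mem_Icc hk m2
  have h1 : |x ^ p - y ^ p| ≤ p * (32 * T * κ) := by
    refine (abs_pow_sub_pow_le_mul hx hy p).trans ?_
    gcongr
    refine (abs_fejerBump_sub_le hk m1 m2).trans ?_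
    rw [show β * σ * (ρ ^ 2 / ℓ ^ 2) - β * σ = β * σ * (ρ ^ 2 / ℓ ^ 2 - 1) by ring, abs_mul,
      abs_of_nonneg hβσ0]
    calc 4 * (k : ℝ) ^ 2 * (β * σ * |ρ ^ 2 / ℓ ^ 2 - 1|)
        = 4 * (k ^ 2 * σ) * β * |ρ ^ 2 / ℓ ^ 2 - 1| := by ring
      _ ≤ 4 * T * 1 * (8 * κ) := by
        have : 0 ≤ (k : ℝ) ^ 2 * σ := by positivity
        gcongr <;> linarith
      _ = _ := by ring
  have h2 : 1 - 2 * n * (1 - ℓ) ≤ ℓ ^ (2 * n) := by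
    have := one_add_mul_le_pow (a := ℓ - 1) (by linarith) (2 * n)
    rw [add_sub_cancel] at this
    push_cast at this
    linarith
  have h3 : ℓ ^ (2 * n) ≤ 1 := pow_le_one₀ hℓ0.le hℓ1
  have hxp : x ^ p ≤ 1 := pow_le_one₀ hx.1 hx.2
  have hxp0 : 0 ≤ x ^ p := pow_nonneg hx.1 p
  have h4 : |ℓ ^ (2 * n) * x ^ p - x ^ p| ≤ 2 * n * (1 - ℓ) := by
    rw [abs_le]
    constructor <;> nlinarith
  calc |ℓ ^ (2 * n) * x ^ p - y ^ p|
      = |(ℓ ^ (2 * n) * x ^ p - x ^ p) + (x ^ p - y ^ p)| := by congr 1; ring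
    _ ≤ _ := (abs_add_le _ _).trans (add_le_add h4 h1)

variable {d : ℕ}

theorem norm_sub_sq_le_of_inner_nonneg {u v : EuclideanSpace ℝ (Fin d)} (hu : ‖u‖ = 1)
    (hv : ‖v‖ = 1) (h : 0 ≤ inner ℝ u v) : ‖u - v‖ ^ 2 ≤ 2 * (1 - inner ℝ u v ^ 2) := by
  have h1 := real_inner_le_norm u v
  rw [hu, hv] at h1
  rw [norm_sub_sq_real, hu, hv]
  nlinarith

theorem one_sub_inner_sq_mem {u v : EuclideanSpace ℝ (Fin d)} (hu : ‖u‖ = 1) (hv : ‖v‖ = 1) :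
    1 - (inner ℝ u v : ℝ) ^ 2 ∈ Icc (0 : ℝ) 1 := by
  have h1 := abs_real_inner_le_norm u v
  rw [hu, hv, one_mul] at h1
  have := (sq_le_one_iff_abs_le_one _).2 h1
  exact ⟨by linarith, by nlinarith⟩

/-- The value at `v / N v` of the homogenised kernel attached to the direction `u`. -/
noncomputable def localisedPower (N : EuclideanSpace ℝ (Fin d) → ℝ) (β : ℝ) (k n : ℕ)
    (u v : EuclideanSpace ℝ (Fin d)) : ℝ :=
  (fderiv ℝ N u v / N v) ^ (2 * n) *
    (fejerBump k).eval (β * (1 - inner ℝ u v ^ 2) * (N u / N v) ^ 2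
      / (fderiv ℝ N u v / N v) ^ 2) ^ (d + 1)

theorem localisedPower_neg {N : EuclideanSpace ℝ (Fin d) → ℝ} (hN : ∀ x, N (-x) = N x) (β : ℝ)
    (k n : ℕ) (u v : EuclideanSpace ℝ (Fin d)) :
    localisedPower N β k n u (-v) = localisedPower N β k n u v := by
  simp only [localisedPower, hN, map_neg, inner_neg_right, neg_sq, neg_div]
  rw [pow_mul, pow_mul, neg_sq]

/-- In this window |u - v| = O(1/k) up to the sign of v, so 1 - ℓ = O(k^{-1-ε}) and n(1 - ℓ) =
O(k^{-ε}): here ε > 0 is decisive. -/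
theorem abs_localisedPower_sub_le_local {N : EuclideanSpace ℝ (Fin d) → ℝ} {ε a b H β : ℝ}
    (hN : IsHolderGauge N ε a b H) (hε : 0 < ε) (hβ0 : 0 ≤ β) (hβ : β ≤ 1 / 16)
    {T γ : ℝ} (hT : 0 ≤ T) (hγ : 0 < γ) :
    ∀ᶠ k : ℕ in atTop, ∀ n : ℕ, n ≤ 2 * (d + 1) * k → ∀ u v, ‖u‖ = 1 → ‖v‖ = 1 →
      k ^ 2 * (1 - (inner ℝ u v : ℝ) ^ 2) ≤ T →
      |localisedPower N β k n u v - (fejerBump k).eval (β * (1 - inner ℝ u v ^ 2)) ^ (d + 1)|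
        ≤ γ := by
  set c₁ := H / a * √(2 * T) ^ (1 + ε) with hc₁
  set c₂ := b / a * √(2 * T) with hc₂
  have ha := hN.a_pos
  have hb := hN.b_pos
  have hH := hN.H_nonneg
  have hc₁0 : 0 ≤ c₁ := by positivity
  have hc₂0 : 0 ≤ c₂ := by positivity
  have hlim : Tendsto (fun k : ℕ => c₁ * (k : ℝ) ^ (-ε) + c₂ * (k : ℝ)⁻¹) atTop (𝓝 0) := by
    have h1 : Tendsto (fun k : ℕ => (k : ℝ) ^ (-ε)) atTop (𝓝 0) :=
      (tendsto_rpow_neg_atTop hε).comp tendsto_natCast_atTop_atTop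
    have h2 : Tendsto (fun k : ℕ => (k : ℝ)⁻¹) atTop (𝓝 0) := tendsto_inv_atTop_nhds_zero_nat
    simpa using (h1.const_mul c₁).add (h2.const_mul c₂)
  -- The 4 comes from 2n(1 - ℓ) with n ≤ 2(d+1)k, the 32T from the change in the bump.
  set D : ℝ := (d + 1) * (4 + 32 * T) with hD
  have hD0 : 0 < D := by positivity
  have hsmall : (0 : ℝ) < min (1 / 4) (γ / D) := by positivity
  filter_upwards [hlim.eventually_lt_const hsmall, eventually_gt_atTop 0] with k hκlt hk n hn u v
    hu hv hkT
  have hk' : (0 : ℝ) < k := by positivity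
  -- Both kernels are even in v, so v may be replaced by -v.
  wlog hinner : 0 ≤ (inner ℝ u v : ℝ) generalizing v
  · have h := this (-v) (by rwa [norm_neg]) (by rwa [inner_neg_right, neg_sq])
      (by rw [inner_neg_right]; linarith)
    rwa [localisedPower_neg hN.map_neg, inner_neg_right, neg_sq] at h
  set κ := c₁ * (k : ℝ) ^ (-ε) + c₂ * (k : ℝ)⁻¹ with hκ
  have hκ4 : κ ≤ 1 / 4 := hκlt.le.trans (min_le_left _ _)
  have hκD : κ ≤ γ / D := hκlt.le.trans (min_le_right _ _)
  set σ := 1 - (inner ℝ u v : ℝ) ^ 2 with hσ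
  obtain ⟨hσ0, hσ1⟩ : σ ∈ Icc (0 : ℝ) 1 := one_sub_inner_sq_mem hu hv
  have hδ : ‖u - v‖ ≤ √(2 * T) / k := by
    rw [le_div_iff₀ hk']
    refine Real.le_sqrt_of_sq_le ?_
    have := norm_sub_sq_le_of_inner_nonneg hu hv hinner
    nlinarith [sq_nonneg (k : ℝ)]
  have hNu := hN.le_gauge u hu
  have hNv := hN.le_gauge v hv
  have hNv0 : 0 < N v := ha.trans_le hNv
  have hpow : ‖u - v‖ ^ (1 + ε) ≤ √(2 * T) ^ (1 + ε) * ((k : ℝ) ^ (-ε) * (k : ℝ)⁻¹) := by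
    refine (Real.rpow_le_rpow (norm_nonneg _) hδ (by positivity)).trans (le_of_eq ?_)
    rw [Real.div_rpow (Real.sqrt_nonneg _) hk'.le, div_eq_mul_inv, ← Real.rpow_neg hk'.le,
      neg_add, Real.rpow_add hk', Real.rpow_neg_one, mul_comm ((k : ℝ)⁻¹)]
  have hℓ1 : fderiv ℝ N u v / N v ≤ 1 := by
    rw [div_le_one hNv0]
    exact hN.fderiv_le u hu v
  have hℓ : 1 - fderiv ℝ N u v / N v ≤ c₁ * (k : ℝ) ^ (-ε) * (k : ℝ)⁻¹ := by
    have h1 := hN.tangent u v hu hv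
    have h2 : 1 - fderiv ℝ N u v / N v = (N v - fderiv ℝ N u v) / N v := by field_simp
    rw [h2]
    calc (N v - fderiv ℝ N u v) / N v ≤ (H * ‖u - v‖ ^ (1 + ε)) / a := by
          gcongr
          linarith
      _ ≤ (H * (√(2 * T) ^ (1 + ε) * ((k : ℝ) ^ (-ε) * (k : ℝ)⁻¹))) / a := by gcongr
      _ = _ := by rw [hc₁]; ring
  have hkinv : (k : ℝ)⁻¹ ≤ 1 := inv_le_one_of_one_le₀ (by exact_mod_cast hk)
  have hkε : 0 ≤ (k : ℝ) ^ (-ε) := Real.rpow_nonneg hk'.le _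
  have hc₁k : 0 ≤ c₁ * (k : ℝ) ^ (-ε) := by positivity
  have hc₂k : 0 ≤ c₂ * (k : ℝ)⁻¹ := by positivity
  have hℓκ : 1 - κ ≤ fderiv ℝ N u v / N v := by nlinarith
  have hρ : |N u / N v - 1| ≤ κ := by
    have h2 : N u / N v - 1 = (N u - N v) / N v := by field_simp
    rw [h2, abs_div, abs_of_pos hNv0]
    calc |N u - N v| / N v ≤ (b * ‖u - v‖) / a := by
          gcongr
          exact hN.abs_sub_le u v
      _ ≤ (b * (√(2 * T) / k)) / a := by gcongr
      _ = c₂ * (k : ℝ)⁻¹ := by rw [hc₂]; ring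
      _ ≤ κ := by linarith
  have hmain := abs_localised_sub_le (n := n) (d + 1) hk hβ0 hβ hσ0 hσ1 hkT hκ4 hℓκ hℓ1 hρ
  refine hmain.trans ?_
  have hn' : (n : ℝ) ≤ 2 * (d + 1) * k := by exact_mod_cast hn
  have hκ0 : 0 ≤ κ := by linarith
  have h5 : 2 * (n : ℝ) * (1 - fderiv ℝ N u v / N v) ≤ 4 * (d + 1) * κ := by
    calc 2 * (n : ℝ) * (1 - fderiv ℝ N u v / N v)
        ≤ 2 * (2 * (d + 1) * k) * (c₁ * (k : ℝ) ^ (-ε) * (k : ℝ)⁻¹) := by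
          gcongr
      _ = 4 * (d + 1) * (c₁ * (k : ℝ) ^ (-ε)) := by field_simp; ring
      _ ≤ 4 * (d + 1) * κ := by
          gcongr
          linarith
  push_cast
  rw [le_div_iff₀ hD0] at hκD
  rw [hD] at hκD
  linarith

/-- Off the diagonal the kernel is controlled by the integrable profile `(1 + k² sin²)⁻ᵈ`, and the
error made by freezing it at the diagonal is a small multiple of that profile. -/
theorem abs_localisedPower_sub_le {N : EuclideanSpace ℝ (Fin d) → ℝ} {ε a b H A : ℝ}
    (hN : IsHolderGauge N ε a b H) (hε : 0 < ε) (hA : 1 ≤ A) (hbA : b ^ 2 / a ^ 2 ≤ A)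
    {γ : ℝ} (hγ : 0 < γ) :
    ∀ᶠ n : ℕ in atTop, ∀ u v, ‖u‖ = 1 → ‖v‖ = 1 →
      |localisedPower N (1 / (16 * A)) (n / (d + 1)) n u v
        - (fejerBump (n / (d + 1))).eval (1 / (16 * A) * (1 - inner ℝ u v ^ 2)) ^ (d + 1)|
        ≤ γ * ((1 + ((n / (d + 1) : ℕ) : ℝ) ^ 2 * (1 - inner ℝ u v ^ 2)) ^ d)⁻¹ := by
  have ha := hN.a_pos
  have hb := hN.b_pos
  have hA0 : 0 < A := by linarith
  set β := 1 / (16 * A) with hβ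
  have hβ0 : 0 < β := by positivity
  have hβ1 : β ≤ 1 / 16 := by
    rw [hβ]
    gcongr
    linarith
  -- The kernel decays like m^{-(d+1)} with m = k²σ, one power faster than the profile. The spare
  -- factor makes the ratio at most c/m, hence at most γ/2 once m ≥ T.
  set c : ℝ := 2 * (16 * A ^ 2) ^ (d + 1) * 2 ^ d with hc
  have hc0 : 0 < c := by positivity
  set T := max 1 (2 * c / γ) with hTdef
  have hT1 : 1 ≤ T := le_max_left _ _
  have hcT : c / T ≤ γ / 2 := by
    rw [div_le_iff₀ (by linarith)]
    have : 2 * c / γ ≤ T := le_max_right _ _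
    rw [div_le_iff₀ hγ] at this
    linarith
  have hkn : Tendsto (fun n : ℕ => n / (d + 1)) atTop atTop :=
    Nat.tendsto_div_const_atTop (by omega)
  have hloc := hkn.eventually (abs_localisedPower_sub_le_local hN hε hβ0.le hβ1
    (by linarith : 0 ≤ T) (show 0 < γ * ((1 + T) ^ d)⁻¹ by positivity))
  have hexp : ∀ᶠ n : ℕ in atTop, (1 / 4 : ℝ) ^ n * (1 + (n : ℝ) ^ 2) ^ d ≤ γ / 2 := by
    have h1 : Tendsto (fun n : ℕ => (2 : ℝ) ^ d * ((n : ℝ) ^ (2 * d) * (1 / 4 : ℝ) ^ n)) atTop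
        (𝓝 (2 ^ d * 0)) :=
      (tendsto_pow_const_mul_const_pow_of_abs_lt_one (2 * d)
        (by rw [abs_of_pos] <;> norm_num)).const_mul _
    rw [mul_zero] at h1
    filter_upwards [h1.eventually_le_const (show 0 < γ / 2 by positivity),
      eventually_ge_atTop 1] with n h hn
    refine le_trans ?_ h
    have hn' : (1 : ℝ) ≤ n := by exact_mod_cast hn
    have : (1 + (n : ℝ) ^ 2) ^ d ≤ (2 * (n : ℝ) ^ 2) ^ d := by
      gcongr
      nlinarith
    calc (1 / 4 : ℝ) ^ n * (1 + (n : ℝ) ^ 2) ^ d ≤ (1 / 4 : ℝ) ^ n * (2 * (n : ℝ) ^ 2) ^ d := by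
          gcongr
      _ = _ := by rw [mul_pow, ← pow_mul]; ring
  filter_upwards [hloc, hexp, hkn.eventually_gt_atTop 0, eventually_gt_atTop 0] with n hloc hexp
    hk hn u v hu hv
  set k := n / (d + 1) with hkdef
  have hk' : (0 : ℝ) < k := by positivity
  have hkle : (d + 1) * k ≤ n := Nat.mul_div_le n (d + 1)
  have hkn' : k ≤ n := Nat.div_le_self _ _
  have hnk : n ≤ 2 * (d + 1) * k := by
    have h1 : n < (d + 1) * (k + 1) := by
      simpa [hkdef] using Nat.lt_mul_div_succ n (Nat.succ_pos d)
    nlinarith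
  set σ := 1 - (inner ℝ u v : ℝ) ^ 2 with hσ
  obtain ⟨hσ0, hσ1⟩ : σ ∈ Icc (0 : ℝ) 1 := one_sub_inner_sq_mem hu hv
  rcases le_total ((k : ℝ) ^ 2 * σ) T with hkT | hkT
  · refine (hloc n hnk u v hu hv hkT).trans ?_
    gcongr
  · have hσpos : 0 < σ := by
      rcases hσ0.eq_or_lt with h | h
      · rw [← h, mul_zero] at hkT
        linarith
      · exact h
    set m := (k : ℝ) ^ 2 * σ with hm
    have hm1 : 1 ≤ m := hT1.trans hkT
    have hNu := hN.le_gauge u hu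
    have hNv := hN.le_gauge v hv
    have hNu' := hN.gauge_le u hu
    have hNv' := hN.gauge_le v hv
    have hNv0 : 0 < N v := ha.trans_le hNv
    have hρ : (N u / N v) ^ 2 ≤ A := by
      refine le_trans ?_ hbA
      rw [← div_pow]
      have : 0 ≤ N u := ha.le.trans hNu
      gcongr
    have hρ' : 1 / A ≤ (N u / N v) ^ 2 := by
      have h1 : 1 / A ≤ 1 / (b ^ 2 / a ^ 2) := by gcongr
      refine h1.trans ?_
      rw [one_div_div, ← div_pow]
      have : 0 ≤ N u := ha.le.trans hNu
      gcongr
    have hℓ : |fderiv ℝ N u v / N v| ≤ 1 := by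
      rw [abs_div, abs_of_pos hNv0, div_le_one hNv0, abs_le]
      have h1 := hN.fderiv_le u hu (-v)
      rw [map_neg, hN.map_neg] at h1
      exact ⟨by linarith, hN.fderiv_le u hu v⟩
    have h1 := abs_localised_tail_le (p := d + 1) hk
      (le_trans (Nat.mul_le_mul_left _ (Nat.sub_le k 1)) hkle) hA hσpos hσ1 hρ hρ' hℓ hn
    have hβσ : β * σ ∈ Icc (0 : ℝ) 1 := ⟨by positivity, by nlinarith⟩
    have h2 : (fejerBump k).eval (β * σ) ^ (d + 1) ≤ (16 * A ^ 2 / m) ^ (d + 1) := by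
      have h3 : 1 / (16 * A ^ 2 / m) ≤ (k : ℝ) ^ 2 * (β * σ) := by
        rw [one_div_div, hβ, hm, div_le_iff₀ (by positivity)]
        have : (k : ℝ) ^ 2 * (1 / (16 * A) * σ) * (16 * A ^ 2) = (k ^ 2 * σ) * A := by
          field_simp
        rw [this]
        exact le_mul_of_one_le_right (by positivity) hA
      have h4 := fejerBump_pow_le (p := d + 1) hk hβσ (by positivity) h3
      rwa [one_div_one_div] at h4
    have h2' : 0 ≤ (fejerBump k).eval (β * σ) ^ (d + 1) := pow_nonneg (fejerBump_nonneg hk hβσ) _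
    have h5 : |localisedPower N β k n u v - (fejerBump k).eval (β * σ) ^ (d + 1)|
        ≤ 2 * (16 * A ^ 2 / m) ^ (d + 1) + (1 / 4) ^ n := by
      refine (abs_sub _ _).trans ?_
      rw [abs_of_nonneg h2']
      have h1' : |localisedPower N β k n u v| ≤ (16 * A ^ 2 / m) ^ (d + 1) + (1 / 4) ^ n := h1
      linarith
    refine h5.trans ?_
    rw [← div_eq_mul_inv, le_div_iff₀ (by positivity), add_mul]
    have h6 : 2 * (16 * A ^ 2 / m) ^ (d + 1) * (1 + m) ^ d ≤ γ / 2 := by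
      calc 2 * (16 * A ^ 2 / m) ^ (d + 1) * (1 + m) ^ d
          ≤ 2 * (16 * A ^ 2 / m) ^ (d + 1) * (2 * m) ^ d := by
            gcongr
            linarith
        _ = c / m := by
            rw [hc, div_pow, mul_pow 2 m, pow_succ m]
            field_simp
        _ ≤ c / T := by gcongr
        _ ≤ γ / 2 := hcT
    have h7 : (1 / 4 : ℝ) ^ n * (1 + m) ^ d ≤ γ / 2 := by
      refine le_trans ?_ hexp
      have : m ≤ (n : ℝ) ^ 2 := by
        have h8 : (k : ℝ) ≤ n := by exact_mod_cast hkn'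
        calc m ≤ (k : ℝ) ^ 2 * 1 := mul_le_mul_of_nonneg_left hσ1 (by positivity)
          _ ≤ _ := by rw [mul_one]; exact pow_le_pow_left₀ hk'.le h8 2
      gcongr
    linarith

end Pointwise

/-! ### Integrals of functions of the angle over the unit ball -/

section Ball

open MeasureTheory

/-- The squared sine of the angle between `z` and the unit vector `v`. -/
noncomputable def sinSq {d : ℕ} (v z : EuclideanSpace ℝ (Fin d)) : ℝ :=
  1 - (inner ℝ (‖z‖⁻¹ • z) v) ^ 2

theorem measurable_sinSq {d : ℕ} (v : EuclideanSpace ℝ (Fin d)) : Measurable (sinSq v) := by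
  unfold sinSq
  fun_prop

theorem sinSq_mem {d : ℕ} {v : EuclideanSpace ℝ (Fin d)} (hv : ‖v‖ = 1)
    (z : EuclideanSpace ℝ (Fin d)) : sinSq v z ∈ Icc (0 : ℝ) 1 := by
  rcases eq_or_ne z 0 with rfl | hz
  · simp [sinSq]
  · exact one_sub_inner_sq_mem (norm_smul_inv_norm (𝕜 := ℝ) hz) hv

/-- The reflection exchanging v and w preserves the ball, the volume and angles. -/
theorem setIntegral_ball_sinSq {d : ℕ} (F : ℝ → ℝ) {v w : EuclideanSpace ℝ (Fin d)}
    (h : ‖v‖ = ‖w‖) :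
    ∫ z in Metric.closedBall 0 1, F (sinSq v z) = ∫ z in Metric.closedBall 0 1, F (sinSq w z) := by
  set φ := (Submodule.span ℝ {v - w})ᗮ.reflection with hφ
  have hφv : φ v = w := Submodule.reflection_sub h
  have h1 := φ.measurePreserving.setIntegral_preimage_emb
    φ.toHomeomorph.measurableEmbedding (fun z => F (sinSq w z)) (Metric.closedBall 0 1)
  have h2 : φ ⁻¹' Metric.closedBall 0 1 = Metric.closedBall 0 1 := by
    ext z
    simp
  rw [h2] at h1
  rw [← h1]
  congr 1
  ext z
  congr 1
  simp only [sinSq, φ.norm_map]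
  rw [← hφv, ← map_smul, φ.inner_map_map]

variable {d : ℕ}

theorem norm_sq_eq_sq_add_sum (z : EuclideanSpace ℝ (Fin (d + 1))) :
    ‖z‖ ^ 2 = z 0 ^ 2 + ∑ i : Fin d, z i.succ ^ 2 := by
  rw [EuclideanSpace.real_norm_sq_eq, Fin.sum_univ_succ]

theorem sinSq_single_mul (z : EuclideanSpace ℝ (Fin (d + 1))) (hz : z ≠ 0) :
    sinSq (EuclideanSpace.single 0 1) z * ‖z‖ ^ 2 = ∑ i : Fin d, z i.succ ^ 2 := by
  have hz' : ‖z‖ ≠ 0 := norm_ne_zero_iff.2 hz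
  have h1 : (inner ℝ (‖z‖⁻¹ • z) (EuclideanSpace.single 0 1) : ℝ) = ‖z‖⁻¹ * z 0 := by
    rw [EuclideanSpace.inner_single_right]
    simp
  have h2 := norm_sq_eq_sq_add_sum z
  rw [sinSq, h1]
  field_simp
  linarith

theorem sum_sq_le_sinSq {z : EuclideanSpace ℝ (Fin (d + 1))} (hz : ‖z‖ ≤ 1) :
    ∑ i : Fin d, z i.succ ^ 2 ≤ sinSq (EuclideanSpace.single 0 1) z := by
  rcases eq_or_ne z 0 with rfl | h0
  · simp [sinSq]
  · rw [← sinSq_single_mul z h0]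
    refine mul_le_of_le_one_right (sinSq_mem (by simp) z).1 ?_
    exact pow_le_one₀ (norm_nonneg _) hz

theorem integral_inv_one_add_mul_sq {k : ℝ} (hk : 0 < k) :
    ∫ x : ℝ, (1 + k ^ 2 * x ^ 2)⁻¹ = Real.pi / k := by
  have h := Measure.integral_comp_mul_left (fun x : ℝ => (1 + x ^ 2)⁻¹) k
  rw [integral_univ_inv_one_add_sq, abs_of_pos (inv_pos.2 hk), smul_eq_mul] at h
  simp only [mul_pow] at h
  rw [h]
  ring

theorem integrable_inv_one_add_mul_sq {k : ℝ} (hk : 0 < k) :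
    Integrable fun x : ℝ => (1 + k ^ 2 * x ^ 2)⁻¹ := by
  simpa only [mul_pow] using integrable_inv_one_add_sq.comp_mul_left' hk.ne'

/-- On the unit ball sin² dominates the square of each of the d transverse coordinates. Spending one
factor of the profile on each bounds it by a product of one-variable functions, which Fubini
integrates; the remaining factor is discarded. -/
theorem setIntegral_ball_profile_le {k : ℝ} (hk : 0 < k) :
    ∫ z in Metric.closedBall (0 : EuclideanSpace ℝ (Fin (d + 1))) 1,
      ((1 + k ^ 2 * sinSq (EuclideanSpace.single 0 1) z) ^ (d + 1))⁻¹
      ≤ 2 * (Real.pi / k) ^ d := by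
  set f : Fin (d + 1) → ℝ → ℝ := Fin.cons ((Icc (-1 : ℝ) 1).indicator 1)
    fun _ x => (1 + k ^ 2 * x ^ 2)⁻¹ with hf
  have hf0 : f 0 = (Icc (-1 : ℝ) 1).indicator 1 := rfl
  have hfs : ∀ i : Fin d, f i.succ = fun x => (1 + k ^ 2 * x ^ 2)⁻¹ := fun i => rfl
  have hint : ∀ i, Integrable (f i) := by
    intro i
    refine Fin.cases ?_ (fun i => ?_) i
    · rw [hf0, integrable_indicator_iff measurableSet_Icc]
      exact integrableOn_const (by simp)
    · rw [hfs]
      exact integrable_inv_one_add_mul_sq hk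
  have hprod : ∫ x : Fin (d + 1) → ℝ, ∏ i, f i (x i) = 2 * (Real.pi / k) ^ d := by
    rw [integral_fintype_prod_volume_eq_prod, Fin.prod_univ_succ, hf0,
      integral_indicator measurableSet_Icc]
    simp only [hfs, integral_inv_one_add_mul_sq hk]
    simp [div_pow]
    norm_num
  have hnn : ∀ x : Fin (d + 1) → ℝ, 0 ≤ ∏ i, f i (x i) := fun x => by
    refine Finset.prod_nonneg fun i _ => ?_
    refine Fin.cases ?_ (fun i => ?_) i
    · rw [hf0]
      exact indicator_nonneg (fun _ _ => zero_le_one) _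
    · rw [hfs]
      positivity
  have hI : Integrable fun z : EuclideanSpace ℝ (Fin (d + 1)) => ∏ i, f i (z i) :=
    (PiLp.volume_preserving_ofLp (Fin (d + 1))).integrable_comp_of_integrable
      (Integrable.fintype_prod hint)
  have hE : ∫ z : EuclideanSpace ℝ (Fin (d + 1)), ∏ i, f i (z i) = 2 * (Real.pi / k) ^ d := by
    rw [← hprod]
    exact (PiLp.volume_preserving_ofLp (Fin (d + 1))).integral_comp
      (MeasurableEquiv.toLp 2 (Fin (d + 1) → ℝ)).symm.measurableEmbedding
      (fun x => ∏ i, f i (x i))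
  rw [← hE]
  refine le_trans ?_ (setIntegral_le_integral (s := Metric.closedBall 0 1) hI
    (ae_of_all _ fun z => hnn _))
  refine integral_mono_of_nonneg (ae_of_all _ fun z => ?_) hI.integrableOn ?_
  · have := (sinSq_mem (v := EuclideanSpace.single 0 1) (by simp) z).1
    positivity
  · refine (ae_restrict_iff' measurableSet_closedBall).2 (ae_of_all _ fun z hz => ?_)
    have hz1 : ‖z‖ ≤ 1 := by simpa using hz
    have h1 := sum_sq_le_sinSq hz1
    have h0 : f 0 (z 0) = 1 := by
      rw [hf0, indicator_of_mem, Pi.one_apply]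
      exact abs_le.1 ((PiLp.norm_apply_le z 0).trans hz1)
    simp only
    rw [Fin.prod_univ_succ, h0, one_mul]
    simp only [hfs]
    rw [Finset.prod_inv_distrib]
    refine inv_anti₀ (Finset.prod_pos fun i _ => by positivity) ?_
    have hS : 0 ≤ sinSq (EuclideanSpace.single 0 1) z :=
      (sinSq_mem (v := EuclideanSpace.single 0 1) (by simp) z).1
    calc ∏ i : Fin d, (1 + k ^ 2 * z i.succ ^ 2)
        ≤ ∏ i : Fin d, (1 + k ^ 2 * sinSq (EuclideanSpace.single 0 1) z) := by
          refine Finset.prod_le_prod (fun i _ => by positivity) fun i _ => ?_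
          have := Finset.single_le_sum (f := fun i : Fin d => z i.succ ^ 2)
            (fun i _ => sq_nonneg _) (Finset.mem_univ i)
          gcongr
          exact this.trans h1
      _ = (1 + k ^ 2 * sinSq (EuclideanSpace.single 0 1) z) ^ d := by simp
      _ ≤ _ := pow_le_pow_right₀ (by nlinarith [mul_nonneg (sq_nonneg k) hS]) (Nat.le_succ d)

/-- The set contains the box [1/4, 1/2] × [-η, η]^d: there |z|² ≥ 1/16, so sin² ≤ 16dη², and η is
chosen so that 16k²dη² ≤ c. -/
theorem le_measureReal_sinSq_le {k c : ℝ} (hk : 1 ≤ k) (hc : 0 < c) (hc1 : c ≤ 1) :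
    1 / 4 * (2 * (c / (4 * (d + 1)) / k)) ^ d
      ≤ volume.real {z : EuclideanSpace ℝ (Fin (d + 1)) | z ∈ Metric.closedBall 0 1 ∧
        k ^ 2 * sinSq (EuclideanSpace.single 0 1) z ≤ c} := by
  set η := c / (4 * (d + 1)) / k with hη
  have hη0 : 0 < η := by positivity
  set lo : Fin (d + 1) → ℝ := Fin.cons (1 / 4) fun _ => -η
  set hi : Fin (d + 1) → ℝ := Fin.cons (1 / 2) fun _ => η
  have hlh : lo ≤ hi := by
    intro i
    refine Fin.cases ?_ (fun i => ?_) i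
    · show (1 / 4 : ℝ) ≤ 1 / 2
      norm_num
    · show -η ≤ η
      linarith
  have hbox : volume.real (WithLp.ofLp ⁻¹' Icc lo hi : Set (EuclideanSpace ℝ (Fin (d + 1))))
      = 1 / 4 * (2 * η) ^ d := by
    rw [measureReal_def, (PiLp.volume_preserving_ofLp (Fin (d + 1))).measure_preimage
      measurableSet_Icc.nullMeasurableSet, Real.volume_Icc_pi_toReal hlh, Fin.prod_univ_succ]
    have h1 : ∀ i : Fin d, hi i.succ - lo i.succ = 2 * η := fun i => by
      show η - -η = 2 * η
      ring
    have h2 : hi 0 - lo 0 = 1 / 4 := by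
      show (1 / 2 - 1 / 4 : ℝ) = 1 / 4
      norm_num
    simp [h1, h2]
  rw [← hbox]
  have hfin : volume {z : EuclideanSpace ℝ (Fin (d + 1)) | z ∈ Metric.closedBall 0 1 ∧
        k ^ 2 * sinSq (EuclideanSpace.single 0 1) z ≤ c} ≠ ⊤ :=
    ((measure_mono fun z hz => hz.1).trans_lt measure_closedBall_lt_top).ne
  refine measureReal_mono (fun z hz => ?_) hfin
  obtain ⟨hz1, hz2⟩ := hz
  have h0l : 1 / 4 ≤ z 0 := hz1 0
  have h0u : z 0 ≤ 1 / 2 := hz2 0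
  have hi' : ∀ i : Fin d, z i.succ ^ 2 ≤ η ^ 2 := fun i => by
    have a1 : -η ≤ z i.succ := hz1 i.succ
    have a2 : z i.succ ≤ η := hz2 i.succ
    exact sq_le_sq' a1 a2
  have hsum : ∑ i : Fin d, z i.succ ^ 2 ≤ d * η ^ 2 := by
    refine (Finset.sum_le_card_nsmul _ _ _ fun i _ => hi' i).trans (le_of_eq ?_)
    simp
  have hkη : k ^ 2 * (d * η ^ 2) ≤ c / 16 := by
    have e : k * η = c / (4 * (d + 1)) := by rw [hη]; field_simp
    have e2 : k ^ 2 * (d * η ^ 2) = d * (k * η) ^ 2 := by ring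
    rw [e2, e, div_pow, mul_div_assoc', div_le_iff₀ (by positivity)]
    have hd : (0 : ℝ) ≤ d := Nat.cast_nonneg d
    have : c ^ 2 ≤ c := by nlinarith
    nlinarith [mul_nonneg hd hc.le, mul_nonneg (mul_nonneg hd hd) hc.le]
  have hsum0 : 0 ≤ ∑ i : Fin d, z i.succ ^ 2 := Finset.sum_nonneg fun i _ => sq_nonneg _
  have hns := norm_sq_eq_sq_add_sum z
  have hdη : d * η ^ 2 ≤ c / 16 := by
    refine le_trans ?_ hkη
    exact le_mul_of_one_le_left (by positivity) (one_le_pow₀ hk)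
  have hlow : 1 / 16 ≤ ‖z‖ ^ 2 := by nlinarith
  refine ⟨?_, ?_⟩
  · rw [mem_closedBall_zero_iff]
    refine (sq_le_one_iff₀ (norm_nonneg z)).1 ?_
    nlinarith
  · have hz0 : z ≠ 0 := by
      rintro rfl
      norm_num at hlow
    have h1 := sinSq_single_mul z hz0
    have hS : 0 ≤ sinSq (EuclideanSpace.single 0 1) z :=
      (sinSq_mem (v := EuclideanSpace.single 0 1) (by simp) z).1
    have h2 : sinSq (EuclideanSpace.single 0 1) z * (1 / 16) ≤ d * η ^ 2 := by nlinarith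
    have h3 : k ^ 2 * (sinSq (EuclideanSpace.single 0 1) z * (1 / 16)) ≤ k ^ 2 * (d * η ^ 2) := by
      gcongr
    linarith

/-- The upper bound for the integral and the lower bound for the volume are both of order k^{-d}, so
M does not depend on k. -/
theorem exists_setIntegral_ball_profile_le {c : ℝ} (hc : 0 < c) (hc1 : c ≤ 1) :
    ∃ M > 0, ∀ k : ℝ, 1 ≤ k →
      ∫ z in Metric.closedBall (0 : EuclideanSpace ℝ (Fin (d + 1))) 1,
        ((1 + k ^ 2 * sinSq (EuclideanSpace.single 0 1) z) ^ (d + 1))⁻¹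
      ≤ M * volume.real {z : EuclideanSpace ℝ (Fin (d + 1)) | z ∈ Metric.closedBall 0 1 ∧
        k ^ 2 * sinSq (EuclideanSpace.single 0 1) z ≤ c} := by
  refine ⟨8 * (Real.pi / (2 * (c / (4 * (d + 1))))) ^ d, by positivity, fun k hk => ?_⟩
  have hk0 : 0 < k := by linarith
  refine (setIntegral_ball_profile_le hk0).trans ?_
  refine le_trans (le_of_eq ?_) (mul_le_mul_of_nonneg_left (le_measureReal_sinSq_le hk hc hc1)
    (by positivity))
  have : ∀ x y : ℝ, 8 * x ^ d * (1 / 4 * y ^ d) = 2 * (x * y) ^ d := fun x y => by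
    rw [mul_pow]; ring
  rw [this]
  congr 2
  field_simp

theorem measureReal_sinSq_le_pos {k c : ℝ} (hk : 1 ≤ k) (hc : 0 < c) (hc1 : c ≤ 1) :
    0 < volume.real {z : EuclideanSpace ℝ (Fin (d + 1)) | z ∈ Metric.closedBall 0 1 ∧
        k ^ 2 * sinSq (EuclideanSpace.single 0 1) z ≤ c} := by
  have hk0 : 0 < k := by linarith
  exact lt_of_lt_of_le (by positivity) (le_measureReal_sinSq_le hk hc hc1)

end Ball

/-! ### Averages of families of homogeneous polynomials -/

section Families

open MeasureTheory MvPolynomial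

variable {Ω : Type*} [MeasurableSpace Ω] {d : ℕ}

/-- A family of polynomials whose coefficients are bounded measurable functions of the parameter. -/
def IsBddFamily (P : Ω → MvPolynomial (Fin d) ℝ) : Prop :=
  ∀ α, Measurable (fun z => coeff α (P z)) ∧ ∃ B, ∀ z, |coeff α (P z)| ≤ B

theorem IsBddFamily.const (p : MvPolynomial (Fin d) ℝ) : IsBddFamily fun _ : Ω => p :=
  fun _ => ⟨measurable_const, _, fun _ => le_rfl⟩

theorem IsBddFamily.smul {c : Ω → ℝ} (hc : Measurable c) {B : ℝ} (hB : ∀ z, |c z| ≤ B)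
    (p : MvPolynomial (Fin d) ℝ) : IsBddFamily fun z => C (c z) * p := by
  intro α
  simp only [coeff_C_mul, abs_mul]
  exact ⟨hc.mul_const _, B * |coeff α p|,
    fun z => mul_le_mul_of_nonneg_right (hB z) (abs_nonneg _)⟩

theorem IsBddFamily.sub {P Q : Ω → MvPolynomial (Fin d) ℝ} (hP : IsBddFamily P)
    (hQ : IsBddFamily Q) : IsBddFamily fun z => P z - Q z := by
  intro α
  obtain ⟨h1, B, hB⟩ := hP α
  obtain ⟨h2, D, hD⟩ := hQ α
  simp only [coeff_sub]
  exact ⟨h1.sub h2, B + D, fun z => (abs_sub _ _).trans (add_le_add (hB z) (hD z))⟩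

theorem IsBddFamily.sum {ι : Type*} {s : Finset ι} {P : ι → Ω → MvPolynomial (Fin d) ℝ}
    (hP : ∀ i ∈ s, IsBddFamily (P i)) : IsBddFamily fun z => ∑ i ∈ s, P i z := by
  intro α
  simp only [coeff_sum]
  refine ⟨Finset.measurable_fun_sum s fun i hi => (hP i hi α).1, ?_⟩
  choose! B hB using fun i hi => (hP i hi α).2
  exact ⟨∑ i ∈ s, B i, fun z => (Finset.abs_sum_le_sum_abs _ _).trans
    (Finset.sum_le_sum fun i hi => hB i hi z)⟩

theorem IsBddFamily.mul {P Q : Ω → MvPolynomial (Fin d) ℝ} (hP : IsBddFamily P)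
    (hQ : IsBddFamily Q) : IsBddFamily fun z => P z * Q z := by
  intro α
  simp only [coeff_mul]
  refine ⟨Finset.measurable_fun_sum _ fun i _ => (hP i.1).1.mul (hQ i.2).1, ?_⟩
  choose B hB using fun α => (hP α).2
  choose D hD using fun α => (hQ α).2
  refine ⟨∑ i ∈ Finset.HasAntidiagonal.antidiagonal α, B i.1 * D i.2, fun z =>
    (Finset.abs_sum_le_sum_abs _ _).trans (Finset.sum_le_sum fun i _ => ?_)⟩
  rw [abs_mul]
  exact mul_le_mul (hB _ z) (hD _ z) (abs_nonneg _) ((abs_nonneg _).trans (hB _ z))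

theorem IsBddFamily.pow {P : Ω → MvPolynomial (Fin d) ℝ} (hP : IsBddFamily P) (m : ℕ) :
    IsBddFamily fun z => P z ^ m := by
  induction m with
  | zero => simpa using IsBddFamily.const 1
  | succ m ih => simpa only [pow_succ] using ih.mul hP

theorem eval_eq_sum_finsuppAntidiag {p : MvPolynomial (Fin d) ℝ} {m : ℕ} (hp : p.IsHomogeneous m)
    (x : Fin d → ℝ) :
    eval x p = ∑ α ∈ Finset.finsuppAntidiag Finset.univ m, coeff α p * ∏ i, x i ^ α i := by
  rw [eval_eq']
  refine Finset.sum_subset (fun α hα => ?_) fun α _ hα => ?_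
  · rw [Finset.mem_finsuppAntidiag]
    refine ⟨?_, Finset.subset_univ _⟩
    have := hp (mem_support_iff.1 hα)
    rw [← this, Finsupp.weight_apply, Finsupp.sum_fintype] <;> simp
  · rw [notMem_support_iff.1 hα, zero_mul]

/-- Integrate coefficientwise; homogeneity confines all exponents to one finite set. -/
theorem IsBddFamily.exists_integral {P : Ω → MvPolynomial (Fin d) ℝ} (hP : IsBddFamily P) {m : ℕ}
    (hm : ∀ z, (P z).IsHomogeneous m) (μ : Measure Ω) [IsFiniteMeasure μ] :
    ∃ p : MvPolynomial (Fin d) ℝ, p.IsHomogeneous m ∧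
      ∀ x, Integrable (fun z => eval x (P z)) μ ∧ eval x p = ∫ z, eval x (P z) ∂μ := by
  have hint : ∀ α, Integrable (fun z => coeff α (P z)) μ := fun α => by
    obtain ⟨h1, B, hB⟩ := hP α
    exact Integrable.of_bound h1.aestronglyMeasurable B (ae_of_all _ hB)
  refine ⟨∑ α ∈ Finset.finsuppAntidiag Finset.univ m, monomial α (∫ z, coeff α (P z) ∂μ), ?_,
    fun x => ⟨?_, ?_⟩⟩
  · refine IsHomogeneous.sum _ _ _ fun α hα => isHomogeneous_monomial _ ?_
    rw [Finset.mem_finsuppAntidiag] at hα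
    rw [Finsupp.degree_eq_sum]
    exact hα.1
  · simp only [eval_eq_sum_finsuppAntidiag (hm _)]
    exact integrable_finsetSum _ fun α _ => (hint α).mul_const _
  · simp only [eval_eq_sum_finsuppAntidiag (hm _)]
    rw [integral_finsetSum _ fun α _ => (hint α).mul_const _, map_sum]
    refine Finset.sum_congr rfl fun α _ => ?_
    rw [integral_mul_const, eval_monomial, Finsupp.prod_fintype _ _ (by simp)]

end Families

/-! ### Localised kernels as homogeneous polynomials -/

section KernelPolynomial

open MvPolynomial

variable {d : ℕ}

/-- A linear functional on Euclidean space as a linear form. -/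
noncomputable def linearForm (φ : EuclideanSpace ℝ (Fin d) →L[ℝ] ℝ) : MvPolynomial (Fin d) ℝ :=
  ∑ i, C (φ (EuclideanSpace.single i 1)) * X i

theorem eval_linearForm (φ : EuclideanSpace ℝ (Fin d) →L[ℝ] ℝ) (x : EuclideanSpace ℝ (Fin d)) :
    eval (fun i => x i) (linearForm φ) = φ x := by
  have h : x = ∑ i, x i • EuclideanSpace.single i (1 : ℝ) := by
    ext j
    simp [Finset.sum_apply, Pi.single_apply]
  conv_rhs => rw [h]
  simp [linearForm, mul_comm]

theorem isHomogeneous_linearForm (φ : EuclideanSpace ℝ (Fin d) →L[ℝ] ℝ) :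
    (linearForm φ).IsHomogeneous 1 :=
  IsHomogeneous.sum _ _ _ fun i _ => by
    simpa using (isHomogeneous_C (Fin d) _).mul (isHomogeneous_X ℝ i)

/-- The quadratic form `x ↦ c (‖x‖² - ⟪u, x⟫²)`. -/
noncomputable def angleForm (c : ℝ) (u : EuclideanSpace ℝ (Fin d)) : MvPolynomial (Fin d) ℝ :=
  C c * (∑ i, X i ^ 2 - linearForm (innerSL ℝ u) ^ 2)

theorem eval_angleForm (c : ℝ) (u x : EuclideanSpace ℝ (Fin d)) :
    eval (fun i => x i) (angleForm c u) = c * (‖x‖ ^ 2 - inner ℝ u x ^ 2) := by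
  rw [angleForm, map_mul, map_sub, map_pow, eval_linearForm, EuclideanSpace.real_norm_sq_eq]
  simp

theorem isHomogeneous_angleForm (c : ℝ) (u : EuclideanSpace ℝ (Fin d)) :
    (angleForm c u).IsHomogeneous 2 := by
  have h1 : (∑ i : Fin d, (X i : MvPolynomial (Fin d) ℝ) ^ 2).IsHomogeneous 2 :=
    IsHomogeneous.sum _ _ _ fun i _ => by simpa using (isHomogeneous_X ℝ i).pow 2
  have h2 : (linearForm (innerSL ℝ u) ^ 2).IsHomogeneous 2 := by
    simpa using (isHomogeneous_linearForm (innerSL ℝ u)).pow 2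
  simpa [angleForm] using (isHomogeneous_C (Fin d) c).mul (h1.sub h2)

/-- The homogenisation `L ^ (2 n) * J (Q / L ^ 2)` of a univariate polynomial `J`. -/
noncomputable def homogenised (J : Polynomial ℝ) (n : ℕ) (L Q : MvPolynomial (Fin d) ℝ) :
    MvPolynomial (Fin d) ℝ :=
  ∑ j ∈ Finset.range n, C (J.coeff j) * ((L ^ 2) ^ (n - j) * Q ^ j)

theorem isHomogeneous_homogenised (J : Polynomial ℝ) (n : ℕ) {L Q : MvPolynomial (Fin d) ℝ}
    (hL : L.IsHomogeneous 1) (hQ : Q.IsHomogeneous 2) :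
    (homogenised J n L Q).IsHomogeneous (2 * n) := by
  refine IsHomogeneous.sum _ _ _ fun j hj => ?_
  have hj' := Finset.mem_range.1 hj
  have h := (isHomogeneous_C (Fin d) (J.coeff j)).mul (((hL.pow 2).pow (n - j)).mul (hQ.pow j))
  convert h using 1
  omega

/-- The strict degree bound leaves a positive power of L² in every term, so both sides vanish where
L does, whatever value division by zero takes. -/
theorem eval_homogenised {J : Polynomial ℝ} {n : ℕ} (hJ : J.natDegree < n)
    (L Q : MvPolynomial (Fin d) ℝ) (x : Fin d → ℝ) :
    eval x (homogenised J n L Q)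
      = eval x L ^ (2 * n) * J.eval (eval x Q / eval x L ^ 2) := by
  simp only [homogenised, map_sum, map_mul, map_pow, eval_C]
  rcases eq_or_ne (eval x L) 0 with h0 | h0
  · rw [h0, zero_pow (n := 2 * n) (by omega), zero_mul]
    refine Finset.sum_eq_zero fun j hj => ?_
    have := Finset.mem_range.1 hj
    rw [zero_pow two_ne_zero, zero_pow (by omega)]
    ring
  · rw [Polynomial.eval_eq_sum_range' hJ, Finset.mul_sum]
    refine Finset.sum_congr rfl fun j hj => ?_
    have := Finset.mem_range.1 hj
    rw [pow_mul, div_pow]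
    have h2 : (eval x L ^ 2) ^ n = (eval x L ^ 2) ^ (n - j) * (eval x L ^ 2) ^ j := by
      rw [← pow_add, Nat.sub_add_cancel this.le]
    rw [h2]
    field_simp

/-- The homogeneous polynomial of degree `2 n` concentrated near the direction `u`. -/
noncomputable def kernelPoly (N : EuclideanSpace ℝ (Fin d) → ℝ) (β : ℝ) (k n : ℕ)
    (u : EuclideanSpace ℝ (Fin d)) : MvPolynomial (Fin d) ℝ :=
  homogenised (fejerBump k ^ (d + 1)) n (linearForm (fderiv ℝ N u)) (angleForm (β * N u ^ 2) u)

theorem isHomogeneous_kernelPoly (N : EuclideanSpace ℝ (Fin d) → ℝ) (β : ℝ) (k n : ℕ)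
    (u : EuclideanSpace ℝ (Fin d)) : (kernelPoly N β k n u).IsHomogeneous (2 * n) :=
  isHomogeneous_homogenised _ _ (isHomogeneous_linearForm _) (isHomogeneous_angleForm _ _)

theorem eval_kernelPoly (N : EuclideanSpace ℝ (Fin d) → ℝ) (β : ℝ) {k n : ℕ}
    (hkn : (d + 1) * (k - 1) < n) (u : EuclideanSpace ℝ (Fin d)) {v : EuclideanSpace ℝ (Fin d)}
    (hv : ‖v‖ = 1) :
    eval (fun i => ((N v)⁻¹ • v) i) (kernelPoly N β k n u) = localisedPower N β k n u v := by
  have hdeg : (fejerBump k ^ (d + 1)).natDegree < n := by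
    refine lt_of_le_of_lt (Polynomial.natDegree_pow_le.trans ?_) hkn
    exact Nat.mul_le_mul_left _ (natDegree_fejerBump_le k)
  rw [kernelPoly, eval_homogenised hdeg, eval_linearForm, eval_angleForm, localisedPower,
    Polynomial.eval_pow, map_smul, smul_eq_mul, norm_smul, hv, inner_smul_right, norm_inv, mul_one,
    inv_pow, Real.norm_eq_abs, sq_abs]
  have e1 : (N v)⁻¹ * fderiv ℝ N u v = fderiv ℝ N u v / N v := by ring
  have e2 : β * N u ^ 2 * ((N v ^ 2)⁻¹ - ((N v)⁻¹ * inner ℝ u v) ^ 2)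
      = β * (1 - inner ℝ u v ^ 2) * (N u / N v) ^ 2 := by
    ring
  rw [e1, e2]

/-- The Lipschitz bound on N controls `fderiv` at every point, including the value 0 that `‖z‖⁻¹ •
z` takes at the origin. -/
theorem isBddFamily_kernelPoly {N : EuclideanSpace ℝ (Fin d) → ℝ} {ε a b H : ℝ}
    (hN : IsHolderGauge N ε a b H) (β : ℝ) (k n : ℕ) :
    IsBddFamily fun z : EuclideanSpace ℝ (Fin d) => kernelPoly N β k n (‖z‖⁻¹ • z) := by
  have hlip : LipschitzWith (Real.toNNReal b) N := LipschitzWith.of_dist_le_mul fun x y => by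
    rw [Real.dist_eq, dist_eq_norm, Real.coe_toNNReal _ hN.b_pos.le]
    exact hN.abs_sub_le x y
  have hu : Measurable fun z : EuclideanSpace ℝ (Fin d) => ‖z‖⁻¹ • z := by fun_prop
  have hnorm : ∀ z : EuclideanSpace ℝ (Fin d), ‖‖z‖⁻¹ • z‖ ≤ 1 := fun z => by
    rw [norm_smul, norm_inv, norm_norm]
    exact inv_mul_le_one
  have hNm : Measurable fun z : EuclideanSpace ℝ (Fin d) => N (‖z‖⁻¹ • z) :=
    hlip.continuous.measurable.comp hu
  have hNb : ∀ z : EuclideanSpace ℝ (Fin d), |N (‖z‖⁻¹ • z)| ≤ b := fun z => by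
    have h0 : N 0 = 0 := by simpa using hN.map_smul 0 le_rfl 0
    have h1 := hN.abs_sub_le (‖z‖⁻¹ • z) 0
    rw [h0, sub_zero, sub_zero] at h1
    exact h1.trans (mul_le_of_le_one_right hN.b_pos.le (hnorm z))
  have hform : ∀ (φ : EuclideanSpace ℝ (Fin d) → EuclideanSpace ℝ (Fin d) →L[ℝ] ℝ) (B : ℝ),
      (∀ y, Measurable fun z => φ z y) → (∀ z, ‖φ z‖ ≤ B) →
      IsBddFamily fun z => linearForm (φ z) := by
    intro φ B hφ hB
    refine IsBddFamily.sum fun i _ => IsBddFamily.smul (hφ _) (B := B) (fun z => ?_) _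
    have := (φ z).le_opNorm (EuclideanSpace.single i 1)
    simp only [PiLp.norm_single, norm_one, mul_one, Real.norm_eq_abs] at this
    exact this.trans (hB z)
  have hL : IsBddFamily fun z : EuclideanSpace ℝ (Fin d) => linearForm (fderiv ℝ N (‖z‖⁻¹ • z)) :=
    hform _ b (fun y => (measurable_fderiv_apply_const ℝ N y).comp hu) fun z => by
      simpa [Real.coe_toNNReal _ hN.b_pos.le] using
        norm_fderiv_le_of_lipschitz ℝ (x₀ := ‖z‖⁻¹ • z) hlip
  have hI : IsBddFamily fun z : EuclideanSpace ℝ (Fin d) => linearForm (innerSL ℝ (‖z‖⁻¹ • z)) :=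
    hform _ 1 (fun y => by simp only [innerSL_apply_apply]; fun_prop) fun z => by
      rw [innerSL_apply_norm]; exact hnorm z
  have hc : IsBddFamily fun z : EuclideanSpace ℝ (Fin d) =>
      (C (β * N (‖z‖⁻¹ • z) ^ 2) : MvPolynomial (Fin d) ℝ) := by
    have := IsBddFamily.smul (c := fun z : EuclideanSpace ℝ (Fin d) => β * N (‖z‖⁻¹ • z) ^ 2)
      ((hNm.pow_const 2).const_mul β) (B := |β| * b ^ 2)
      (fun z => by
        rw [abs_mul, abs_pow]
        gcongr
        exact hNb z) (1 : MvPolynomial (Fin d) ℝ)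
    simpa only [mul_one] using this
  have hQ : IsBddFamily fun z : EuclideanSpace ℝ (Fin d) =>
      angleForm (β * N (‖z‖⁻¹ • z) ^ 2) (‖z‖⁻¹ • z) :=
    hc.mul ((IsBddFamily.const _).sub (hI.pow 2))
  exact IsBddFamily.sum fun j _ =>
    (IsBddFamily.const _).mul (((hL.pow 2).pow (n - j)).mul (hQ.pow j))

end KernelPolynomial

/-! ### Approximation of the constant function `1` -/

section ApproxOne

open MeasureTheory

variable {d : ℕ}

/-- The bump is 1 at 0 with Lipschitz constant 4k², so its p-th power drops by at most p·k²σ/4. This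
bounds the normalising constant Z from below. -/
theorem half_le_fejerBump_pow {k p : ℕ} (hk : 0 < k) {β σ : ℝ} (hβ0 : 0 ≤ β) (hβ : β ≤ 1 / 16)
    (hσ : σ ∈ Icc (0 : ℝ) 1) (h : (k : ℝ) ^ 2 * σ ≤ 1 / (p + 1)) :
    1 / 2 ≤ (fejerBump k).eval (β * σ) ^ p := by
  have hβσ : β * σ ∈ Icc (0 : ℝ) 1 := ⟨mul_nonneg hβ0 hσ.1, by nlinarith [hσ.1, hσ.2]⟩
  have h0 : (0 : ℝ) ∈ Icc (0 : ℝ) 1 := ⟨le_rfl, zero_le_one⟩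
  have h1 := abs_pow_sub_pow_le_mul (fejerBump_mem_Icc hk hβσ) (fejerBump_mem_Icc hk h0) p
  have h2 := abs_fejerBump_sub_le hk hβσ h0
  rw [fejerBump_eval_zero hk] at h1 h2
  rw [sub_zero, abs_of_nonneg hβσ.1] at h2
  rw [one_pow] at h1
  rw [le_div_iff₀ (by positivity)] at h
  have h3 : 4 * (k : ℝ) ^ 2 * (β * σ) ≤ (k : ℝ) ^ 2 * σ / 4 := by
    have : 0 ≤ (k : ℝ) ^ 2 * σ := mul_nonneg (sq_nonneg _) hσ.1
    nlinarith
  have h4 : (p : ℝ) * |(fejerBump k).eval (β * σ) - 1| ≤ 1 / 2 := by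
    have h5 : (p : ℝ) * |(fejerBump k).eval (β * σ) - 1| ≤ p * ((k : ℝ) ^ 2 * σ / 4) := by
      gcongr
      exact h2.trans h3
    have : 0 ≤ (k : ℝ) ^ 2 * σ := mul_nonneg (sq_nonneg _) hσ.1
    nlinarith
  linarith [(abs_le.1 (h1.trans h4)).1]

theorem exists_isHomogeneous_near_one {N : EuclideanSpace ℝ (Fin (d + 1)) → ℝ} {ε a b H : ℝ}
    (hN : IsHolderGauge N ε a b H) (hε : 0 < ε) {γ : ℝ} (hγ : 0 < γ) :
    ∀ᶠ n : ℕ in atTop, ∃ p : MvPolynomial (Fin (d + 1)) ℝ, p.IsHomogeneous (2 * n) ∧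
      ∀ x : EuclideanSpace ℝ (Fin (d + 1)), N x = 1 →
        |MvPolynomial.eval (fun i => x i) p - 1| ≤ γ := by
  set e : EuclideanSpace ℝ (Fin (d + 1)) := EuclideanSpace.single 0 1 with he
  have hen : ‖e‖ = 1 := by simp [he]
  set A := max 1 (b ^ 2 / a ^ 2) with hAdef
  have hA : 1 ≤ A := le_max_left _ _
  set β := 1 / (16 * A) with hβ
  have hβ0 : 0 ≤ β := by positivity
  have hβ1 : β ≤ 1 / 16 := by
    rw [hβ]
    gcongr
    linarith
  set c : ℝ := 1 / (((d + 1 + 1 : ℕ) : ℝ) + 1) with hc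
  have hc0 : 0 < c := by positivity
  have hc1 : c ≤ 1 := by
    rw [hc, div_le_one (by positivity)]
    push_cast
    have : (0 : ℝ) ≤ d := Nat.cast_nonneg d
    linarith
  obtain ⟨M, hM, hprof⟩ := exists_setIntegral_ball_profile_le (d := d) hc0 hc1
  have hkn : Tendsto (fun n : ℕ => n / (d + 1 + 1)) atTop atTop :=
    Nat.tendsto_div_const_atTop (by omega)
  -- In γ/(2M), M pays for the integral of the profile (at most MW) and 2 for Z ≥ W/2.
  filter_upwards [abs_localisedPower_sub_le hN hε hA (le_max_right _ _)
    (show 0 < γ / (2 * M) by positivity), hkn.eventually_gt_atTop 0] with n hest hk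
  set k := n / (d + 1 + 1) with hkdef
  have hk1 : (1 : ℝ) ≤ k := by exact_mod_cast hk
  have hkn' : (d + 1 + 1) * (k - 1) < n := by
    have h1 : (d + 1 + 1) * k ≤ n := Nat.mul_div_le n _
    exact lt_of_lt_of_le (Nat.mul_lt_mul_of_pos_left (by omega) (by omega)) h1
  set J : ℝ → ℝ := fun σ => (fejerBump k).eval (β * σ) ^ (d + 1 + 1) with hJ
  have hJm : Measurable J := by
    have : Continuous J := by
      simp only [hJ]
      fun_prop
    exact this.measurable
  have hJ01 : ∀ σ ∈ Icc (0 : ℝ) 1, J σ ∈ Icc (0 : ℝ) 1 := fun σ hσ => by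
    have h := fejerBump_mem_Icc hk (t := β * σ)
      ⟨mul_nonneg hβ0 hσ.1, by nlinarith [hσ.1, hσ.2]⟩
    exact ⟨pow_nonneg h.1 _, pow_le_one₀ h.1 h.2⟩
  set B : Set (EuclideanSpace ℝ (Fin (d + 1))) := Metric.closedBall 0 1 with hB
  have hBfin : volume B ≠ ⊤ := measure_closedBall_lt_top.ne
  have : IsFiniteMeasure (volume.restrict B) := ⟨by
    rw [Measure.restrict_apply_univ]; exact hBfin.lt_top⟩
  have hJint : ∀ v, ‖v‖ = 1 → Integrable (fun z => J (sinSq v z)) (volume.restrict B) :=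
    fun v hv => Integrable.of_bound (hJm.comp (measurable_sinSq v)).aestronglyMeasurable 1
      (ae_of_all _ fun z => by
        have := hJ01 _ (sinSq_mem hv z)
        rw [Real.norm_of_nonneg this.1]
        exact this.2)
  set Z := ∫ z in B, J (sinSq e z) with hZ
  set W := volume.real {z : EuclideanSpace ℝ (Fin (d + 1)) | z ∈ Metric.closedBall 0 1 ∧
        (k : ℝ) ^ 2 * sinSq (EuclideanSpace.single 0 1) z ≤ c} with hW
  have hWpos : 0 < W := measureReal_sinSq_le_pos hk1 hc0 hc1
  have hWZ : 1 / 2 * W ≤ Z := by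
    have hSm : MeasurableSet {z : EuclideanSpace ℝ (Fin (d + 1)) | z ∈ Metric.closedBall 0 1 ∧
        (k : ℝ) ^ 2 * sinSq (EuclideanSpace.single 0 1) z ≤ c} :=
      measurableSet_closedBall.inter
        (measurableSet_le ((measurable_sinSq _).const_mul _) measurable_const)
    have h1 : ∫ z in {z : EuclideanSpace ℝ (Fin (d + 1)) | z ∈ Metric.closedBall 0 1 ∧
        (k : ℝ) ^ 2 * sinSq (EuclideanSpace.single 0 1) z ≤ c}, J (sinSq e z) ≤ Z :=
      setIntegral_mono_set (hJint e hen) (ae_of_all _ fun z => (hJ01 _ (sinSq_mem hen z)).1)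
        (LE.le.eventuallyLE fun z hz => hz.1)
    refine le_trans ?_ h1
    have h2 := setIntegral_ge_of_const_le_real (c := (1 / 2 : ℝ)) (μ := volume) hSm
      ((measure_mono fun z hz => hz.1).trans_lt hBfin.lt_top).ne
      (f := fun z => J (sinSq e z))
      (fun z hz => half_le_fejerBump_pow hk hβ0 hβ1 (sinSq_mem hen z) hz.2)
      (IntegrableOn.mono_set (hJint e hen) fun z hz => hz.1)
    exact h2
  have hZpos : 0 < Z := by linarith
  obtain ⟨p, hp, hpe⟩ := (isBddFamily_kernelPoly hN β k n).exists_integral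
    (fun z => isHomogeneous_kernelPoly N β k n _) (volume.restrict B)
  refine ⟨MvPolynomial.C Z⁻¹ * p, by
    simpa using (MvPolynomial.isHomogeneous_C (Fin (d + 1)) Z⁻¹).mul hp, fun x hx => ?_⟩
  have hN0 : N 0 = 0 := by simpa using hN.map_smul 0 le_rfl 0
  have hx0 : x ≠ 0 := by
    rintro rfl
    rw [hN0] at hx
    exact zero_ne_one hx
  have hxn : ‖x‖ ≠ 0 := norm_ne_zero_iff.2 hx0
  set v := ‖x‖⁻¹ • x with hv
  have hvn : ‖v‖ = 1 := norm_smul_inv_norm (𝕜 := ℝ) hx0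
  have hNv : N v = ‖x‖⁻¹ := by rw [hv, hN.map_smul _ (by positivity), hx, mul_one]
  have hxv : x = (N v)⁻¹ • v := by rw [hNv, hv, smul_smul, inv_inv, mul_inv_cancel₀ hxn, one_smul]
  have hker : ∀ u, MvPolynomial.eval (fun i => x i) (kernelPoly N β k n u)
      = localisedPower N β k n u v := fun u => by
    conv_lhs => rw [hxv]
    exact eval_kernelPoly N β hkn' u hvn
  obtain ⟨hint, hpx⟩ := hpe fun i => x i
  simp only [hker] at hint hpx
  have hZv : Z = ∫ z in B, J (sinSq v z) := setIntegral_ball_sinSq J (hen.trans hvn.symm)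
  have hprofint : Integrable (fun z => γ / (2 * M) *
      ((1 + (k : ℝ) ^ 2 * sinSq v z) ^ (d + 1))⁻¹) (volume.restrict B) := by
    refine (Integrable.of_bound ?_ 1 (ae_of_all _ fun z => ?_)).const_mul _
    · have := measurable_sinSq v
      exact Measurable.aestronglyMeasurable (by fun_prop)
    · have := (sinSq_mem hvn z).1
      rw [Real.norm_of_nonneg (by positivity)]
      exact inv_le_one_of_one_le₀ (one_le_pow₀ (by nlinarith [mul_nonneg (sq_nonneg (k : ℝ)) this]))
  have hdiff : |MvPolynomial.eval (fun i => x i) p - Z| ≤ γ * Z := by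
    rw [hpx, hZv, ← integral_sub hint (hJint v hvn), ← hZv]
    calc |∫ z in B, (localisedPower N β k n (‖z‖⁻¹ • z) v - J (sinSq v z))|
        ≤ ∫ z in B, γ / (2 * M) * ((1 + (k : ℝ) ^ 2 * sinSq v z) ^ (d + 1))⁻¹ := by
          rw [← Real.norm_eq_abs]
          refine norm_integral_le_of_norm_le hprofint ?_
          -- The origin, which has no direction, is a null set.
          refine ae_restrict_of_ae ?_
          filter_upwards [compl_mem_ae_iff.2 (measure_singleton
            (0 : EuclideanSpace ℝ (Fin (d + 1))))] with z hz
          exact hest (‖z‖⁻¹ • z) v (norm_smul_inv_norm (𝕜 := ℝ) hz) hvn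
      _ = γ / (2 * M) * ∫ z in B, ((1 + (k : ℝ) ^ 2 * sinSq e z) ^ (d + 1))⁻¹ := by
          rw [integral_const_mul, setIntegral_ball_sinSq
            (fun σ => ((1 + (k : ℝ) ^ 2 * σ) ^ (d + 1))⁻¹) (hvn.trans hen.symm)]
      _ ≤ γ / (2 * M) * (M * W) := by
          gcongr
          exact hprof k hk1
      _ = γ * (1 / 2 * W) := by field_simp
      _ ≤ γ * Z := by gcongr
  rw [map_mul, MvPolynomial.eval_C]
  have : Z⁻¹ * MvPolynomial.eval (fun i => x i) p - 1
      = (MvPolynomial.eval (fun i => x i) p - Z) / Z := by field_simp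
  rw [this, abs_div, abs_of_pos hZpos, div_le_iff₀ hZpos]
  exact hdiff

end ApproxOne

/-! ### From the constant function to all continuous functions -/

section Assembly

open MvPolynomial

variable {d : ℕ}

/-- The algebra homomorphism sending a polynomial to its evaluation on a subset of Euclidean
space. -/
noncomputable def evalOn (S : Set (EuclideanSpace ℝ (Fin d))) :
    MvPolynomial (Fin d) ℝ →ₐ[ℝ] C(S, ℝ) :=
  aeval fun i => ⟨fun x => (x : EuclideanSpace ℝ (Fin d)) i, by fun_prop⟩

theorem evalOn_apply (S : Set (EuclideanSpace ℝ (Fin d))) (q : MvPolynomial (Fin d) ℝ) (x : S) :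
    evalOn S q x = eval (fun i => (x : EuclideanSpace ℝ (Fin d)) i) q := by
  induction q using MvPolynomial.induction_on with
  | C a => simp [evalOn]
  | add p q hp hq => rw [map_add, ContinuousMap.add_apply, hp, hq, map_add]
  | mul_X p i hp =>
    rw [map_mul, ContinuousMap.mul_apply, hp, map_mul, eval_X]
    simp [evalOn]

theorem exists_mvPolynomial_near {S : Set (EuclideanSpace ℝ (Fin d))} (hS : IsCompact S)
    {f : EuclideanSpace ℝ (Fin d) → ℝ} (hf : ContinuousOn f S) {γ : ℝ} (hγ : 0 < γ) :
    ∃ q : MvPolynomial (Fin d) ℝ, ∀ x ∈ S, |eval (fun i => x i) q - f x| < γ := by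
  have := isCompact_iff_compactSpace.1 hS
  have hsep : (evalOn S).range.SeparatesPoints := by
    intro x y hxy
    obtain ⟨i, hi⟩ : ∃ i, (x : EuclideanSpace ℝ (Fin d)) i ≠ (y : EuclideanSpace ℝ (Fin d)) i := by
      by_contra! h
      exact hxy (Subtype.ext (PiLp.ext h))
    exact ⟨_, ⟨evalOn S (X i), ⟨X i, rfl⟩, rfl⟩, by simpa [evalOn_apply] using hi⟩
  obtain ⟨⟨_, q, rfl⟩, hg⟩ :=
    ContinuousMap.exists_mem_subalgebra_near_continuous_of_separatesPoints _ hsep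
      (S.domRestrict f) hf.domRestrict γ hγ
  refine ⟨q, fun x hx => ?_⟩
  have h : evalOn S q ⟨x, hx⟩ = eval (fun i => x i) q := evalOn_apply S q ⟨x, hx⟩
  have h2 : ‖evalOn S q ⟨x, hx⟩ - f x‖ < γ := hg ⟨x, hx⟩
  rwa [h] at h2

/-- Approximants that exist eventually for every accuracy can be chosen as a single uniformly
convergent sequence. -/
theorem exists_seq_tendstoUniformlyOn {S : Set (EuclideanSpace ℝ (Fin d))}
    {f : EuclideanSpace ℝ (Fin d) → ℝ} (V : ℕ → Submodule ℝ (MvPolynomial (Fin d) ℝ))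
    (h : ∀ γ > 0, ∀ᶠ n in atTop, ∃ p ∈ V n, ∀ x ∈ S, |eval (fun i => x i) p - f x| ≤ γ) :
    ∃ p : ℕ → MvPolynomial (Fin d) ℝ, (∀ n, p n ∈ V n) ∧
      TendstoUniformlyOn (fun n x => eval (fun i => x i) (p n)) f atTop S := by
  classical
  -- Diagonal choice: for each n use the best accuracy 1/(m+1) with m ≤ n attainable in `V n`, and 0
  -- if there is none.
  let P : ℕ → ℕ → Prop := fun n m =>
    ∃ p ∈ V n, ∀ x ∈ S, |eval (fun i => x i) p - f x| ≤ 1 / ((m : ℝ) + 1)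
  have hch : ∀ n, ∃ p ∈ V n, P n (Nat.findGreatest (P n) n) →
      ∀ x ∈ S, |eval (fun i => x i) p - f x| ≤ 1 / ((Nat.findGreatest (P n) n : ℝ) + 1) := by
    intro n
    by_cases hP : P n (Nat.findGreatest (P n) n)
    · obtain ⟨p, hp, hpx⟩ := hP
      exact ⟨p, hp, fun _ => hpx⟩
    · exact ⟨0, zero_mem _, fun h => (hP h).elim⟩
  choose p hpV hp using hch
  refine ⟨p, hpV, Metric.tendstoUniformlyOn_iff.2 fun γ hγ => ?_⟩
  obtain ⟨m, hm⟩ := exists_nat_one_div_lt hγ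
  filter_upwards [h _ (show (0 : ℝ) < 1 / ((m : ℝ) + 1) by positivity), eventually_ge_atTop m]
    with n hn hmn x hx
  have h1 := hp n (Nat.findGreatest_spec hmn hn) x hx
  have h2 : (m : ℝ) ≤ Nat.findGreatest (P n) n := by exact_mod_cast Nat.le_findGreatest hmn hn
  rw [dist_comm, Real.dist_eq]
  refine h1.trans_lt (lt_of_le_of_lt ?_ hm)
  gcongr

theorem exists_homogeneous_pair_near {S : Set (EuclideanSpace ℝ (Fin d))} (hS : IsCompact S)
    (hone : ∀ γ > 0, ∀ᶠ n : ℕ in atTop, ∃ p : MvPolynomial (Fin d) ℝ, p.IsHomogeneous (2 * n) ∧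
      ∀ x ∈ S, |eval (fun i => x i) p - 1| ≤ γ)
    {f : EuclideanSpace ℝ (Fin d) → ℝ} (hf : ContinuousOn f S) {γ : ℝ} (hγ : 0 < γ) :
    ∀ᶠ n : ℕ in atTop,
      ∃ p ∈ homogeneousSubmodule (Fin d) ℝ n ⊔ homogeneousSubmodule (Fin d) ℝ (n - 1),
      ∀ x ∈ S, |eval (fun i => x i) p - f x| ≤ γ := by
  obtain ⟨q, hq⟩ := exists_mvPolynomial_near hS hf (half_pos hγ)
  set D := q.totalDegree + 1 with hD
  set c : ℕ → MvPolynomial (Fin d) ℝ := fun j => homogeneousComponent j q with hc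
  have hcont : ∀ p : MvPolynomial (Fin d) ℝ,
      Continuous fun x : EuclideanSpace ℝ (Fin d) => eval (fun i => x i) p := fun p =>
    (MvPolynomial.continuous_eval p).comp (by fun_prop)
  have hbd : ∀ j, ∃ B, ∀ x ∈ S, |eval (fun i => x i) (c j)| ≤ B := fun j =>
    hS.exists_bound_of_continuousOn (hcont (c j)).continuousOn
  choose B hB using hbd
  set M := ∑ j ∈ Finset.range D, |B j| with hM
  have hM0 : 0 ≤ M := Finset.sum_nonneg fun _ _ => abs_nonneg _
  set δ := γ / (2 * (M + 1)) with hδ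
  have hδ0 : 0 < δ := by positivity
  -- Approximants of 1 come only in even degrees, so component j is raised to degree n or n - 1
  -- according to the parity of n - j.
  have hev : ∀ᶠ n : ℕ in atTop, ∀ j ∈ Finset.range D, ∃ p : MvPolynomial (Fin d) ℝ,
      p.IsHomogeneous (2 * ((n - j) / 2)) ∧ ∀ x ∈ S, |eval (fun i => x i) p - 1| ≤ δ := by
    rw [Filter.eventually_all_finset]
    intro j _
    have ht : Tendsto (fun n : ℕ => (n - j) / 2) atTop atTop :=
      (Nat.tendsto_div_const_atTop two_ne_zero).comp (tendsto_sub_atTop_nat j)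
    exact ht.eventually (hone δ hδ0)
  filter_upwards [hev, eventually_gt_atTop D] with n hn hDn
  choose! g hg hgx using hn
  refine ⟨∑ j ∈ Finset.range D, c j * g j, Submodule.sum_mem _ fun j hj => ?_, fun x hx => ?_⟩
  · have hjD := Finset.mem_range.1 hj
    have hh : (c j * g j).IsHomogeneous (j + 2 * ((n - j) / 2)) :=
      (homogeneousComponent_isHomogeneous j q).mul (hg j hj)
    rcases Nat.even_or_odd (n - j) with he | ho
    · refine Submodule.mem_sup_left ?_
      rw [mem_homogeneousSubmodule]
      convert hh using 1
      obtain ⟨r, hr⟩ := he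
      omega
    · refine Submodule.mem_sup_right ?_
      rw [mem_homogeneousSubmodule]
      convert hh using 1
      obtain ⟨r, hr⟩ := ho
      omega
  · have hsum : eval (fun i => x i) q = ∑ j ∈ Finset.range D, eval (fun i => x i) (c j) := by
      rw [← map_sum, sum_homogeneousComponent]
    have h1 : |eval (fun i => x i) (∑ j ∈ Finset.range D, c j * g j) - eval (fun i => x i) q|
        ≤ M * δ := by
      rw [hsum, map_sum, ← Finset.sum_sub_distrib, hM, Finset.sum_mul]
      refine (Finset.abs_sum_le_sum_abs _ _).trans (Finset.sum_le_sum fun j hj => ?_)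
      rw [map_mul, ← mul_sub_one, abs_mul]
      exact mul_le_mul ((hB j x hx).trans (le_abs_self _)) (hgx j hj x hx) (abs_nonneg _)
        (abs_nonneg _)
    have h2 : M * δ ≤ γ / 2 := by
      rw [hδ, mul_div_assoc', div_le_div_iff₀ (by positivity) two_pos]
      nlinarith
    have h3 := hq x hx
    have h4 := abs_sub_le (eval (fun i => x i) (∑ j ∈ Finset.range D, c j * g j))
      (eval (fun i => x i) q) (f x)
    linarith

end Assembly

theorem theorem2 {d : ℕ} (K : ConvexBody (EuclideanSpace ℝ (Fin d)))
    (hint : (interior (K : Set (EuclideanSpace ℝ (Fin d)))).Nonempty)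
    (hsymm : ∀ x ∈ (K : Set (EuclideanSpace ℝ (Fin d))), -x ∈ (K : Set (EuclideanSpace ℝ (Fin d))))
    (ε : ℝ) (hε : 0 < ε) (hε1 : ε ≤ 1)
    (hK : IsC1Plus ε (K : Set (EuclideanSpace ℝ (Fin d))))
    (f : EuclideanSpace ℝ (Fin d) → ℝ)
    (hf : ContinuousOn f (frontier (K : Set (EuclideanSpace ℝ (Fin d))))) :
    ∃ h : ℕ → MvPolynomial (Fin d) ℝ,
      (∀ n : ℕ, 1 ≤ n →
        h n ∈ MvPolynomial.homogeneousSubmodule (Fin d) ℝ n ⊔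
          MvPolynomial.homogeneousSubmodule (Fin d) ℝ (n - 1)) ∧
      TendstoUniformlyOn (fun n x => MvPolynomial.eval (fun i => x i) (h n)) f atTop
        (frontier (K : Set (EuclideanSpace ℝ (Fin d)))) := by
  have h0 := mem_nhds_zero_of_symmetric K.convex hint hsymm
  have hcomp : IsCompact (frontier (K : Set (EuclideanSpace ℝ (Fin d)))) :=
    K.isCompact.of_isClosed_subset isClosed_frontier K.isCompact.isClosed.frontier_subset
  have hone : ∀ γ > 0, ∀ᶠ n : ℕ in atTop, ∃ p : MvPolynomial (Fin d) ℝ, p.IsHomogeneous (2 * n) ∧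
      ∀ x ∈ frontier (K : Set (EuclideanSpace ℝ (Fin d))),
        |MvPolynomial.eval (fun i => x i) p - 1| ≤ γ := by
    intro γ hγ
    cases d with
    | zero =>
      -- In dimension 0 the boundary is empty: the only point has gauge 0, not 1.
      refine Eventually.of_forall fun n => ⟨0, MvPolynomial.isHomogeneous_zero _ _ _, fun x hx => ?_⟩
      have hx1 := (gauge_eq_one_iff_mem_frontier K.convex h0).2 hx
      rw [Subsingleton.elim x 0, gauge_zero] at hx1
      exact absurd hx1 zero_ne_one
    | succ d =>
      obtain ⟨a, b, H, hN⟩ := isHolderGauge_gauge hε hε1 K.convex K.isCompact h0 hsymm hK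
      filter_upwards [exists_isHomogeneous_near_one hN hε hγ] with n ⟨p, hp, hpx⟩
      exact ⟨p, hp, fun x hx => hpx x ((gauge_eq_one_iff_mem_frontier K.convex h0).2 hx)⟩
  obtain ⟨p, hp, hlim⟩ := exists_seq_tendstoUniformlyOn _ fun γ hγ =>
    exists_homogeneous_pair_near hcomp hone hf hγ
  exact ⟨p, fun n _ => hp n, hlim⟩
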